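/- Let $n\ge 1$, $m\ge 0$, $0<s<1$, $1\le p<\infty$ with $sp<n$, and let $F\subset\mathbb R^m$ be an arbitrary set. Let $\Omega,\omega\subset\mathbb R^n$ be smooth bounded open sets (not necessarily connected) with $\overline\Omega\subset\omega$. For $A\subset\mathbb R^n$, let $W^{s,p}(A;F)$ be the set of measurable $u:A\to\mathbb R^m$ with $u(x)\in F$ for a.e. $x\in A$ and $$\|u\|_{W^{s,p}(A)}=\|u\|_{L^p(A)}+\Big(\int_A\int_A\frac{|u(x)-u(y)|^p}{|x-y|^{n+sp}}\,dx\,dy\Big)^{1/p}<\infty .$$ A *finite mesh* $\mathscr C$ is given by $T\in\mathbb R^n$, $\varepsilon>0$ and finitely many of the closed cubes $T+2\varepsilon K+[-\varepsilon,\varepsilon]^n$, $K\in\mathbb Z^n$; we also write $\mathscr C$ for their union. Its $\ell$-skeleton is the union of all $\ell$-dimensional faces of these cubes ($0\le \ell\le n$). Let $0\le\ell<n$. A map $h$ on the $(\ell+1)$-skeleton is a *homogeneous extension* of a map $g$ on the $\ell$-skeleton if, on each $(\ell+1)$-dimensional face with center $z$, $$h(x)=g\Big(z+\varepsilon\,\frac{x-z}{|x-z|_\infty}\Big)\quad\text{for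 all } x\ne z$$ (no condition is imposed on $h(z)$). For $0\le j\le n-1$, a map $h:\mathscr C\to\mathbb R^m$ is *piecewise $j$-homogeneous* if it is obtained from its own restriction to the $j$-skeleton by $n-j$ successive homogeneous extensions, from the $\ell$-skeleton to the $(\ell+1)$-skeleton for $\ell=j,\dots,n-1$. **Theorem.** Let $f\in W^{s,p}(\omega;F)$ and let $j$ be an integer with $[sp]\le j\le n-1$, where $[sp]$ is the integer part of $sp$. Then there exist finite meshes $\mathscr C^k$ and maps $f_k:\mathscr C^k\to F$, $k\in\mathbb N$, such that $\overline\Omega\subset\mathscr C^k\subset\omega$ for every $k$ and a) each $f_k$ is piecewise $j$-homogeneous on $\mathscr C^k$; b) each $f_k$ belongs to $W^{s,p}(\mathscr C^k;F)$; c) $\|f_k-f\|_{W^{s,p}(\Omega)}\to 0$ as $k\to\infty$. -/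

import Mathlib

open Set Filter Topology MeasureTheory
open scoped ENNReal

/-- An open set of class `C^∞` (no connectedness is required): near each boundary point it is a
strict sublevel set of a smooth function with non-vanishing differential at that point. -/
def IsSmoothOpen {E : Type*} [NormedAddCommGroup E] [NormedSpace ℝ E] (U : Set E) : Prop :=
  IsOpen U ∧ ∀ x ∈ frontier U, ∃ V ∈ 𝓝 x, ∃ φ : E → ℝ,
    ContDiff ℝ ((⊤ : ℕ∞) : WithTop ℕ∞) φ ∧ fderiv ℝ φ x ≠ 0 ∧ ∀ y ∈ V, (y ∈ U ↔ φ y < 0)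

/-- The Gagliardo energy
`|f|_{W^{s,p}(A)}^p = ∫_A ∫_A |f(x) - f(y)|^p / |x - y|^{n + sp} dx dy`, for `A ⊆ ℝⁿ`.
The norm of `x - y` is the sup norm of `ℝⁿ = (Fin n → ℝ)`; replacing it by the Euclidean norm
changes the energy only by a factor between two positive constants depending on `n, s, p`. -/
noncomputable def gagliardoEnergy {n m : ℕ} (s p : ℝ) (A : Set (Fin n → ℝ))
    (f : (Fin n → ℝ) → EuclideanSpace ℝ (Fin m)) : ℝ≥0∞ :=
  ∫⁻ x in A, ∫⁻ y in A, ‖f x - f y‖ₑ ^ p / ‖x - y‖ₑ ^ ((n : ℝ) + s * p)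

/-- The norm of `W^{s,p}(A)` (with value `∞` allowed):
the `L^p` norm plus the Gagliardo seminorm. Only the values of `f` on `A` matter. -/
noncomputable def sobolevNorm {n m : ℕ} (s p : ℝ) (A : Set (Fin n → ℝ))
    (f : (Fin n → ℝ) → EuclideanSpace ℝ (Fin m)) : ℝ≥0∞ :=
  eLpNorm f (ENNReal.ofReal p) (volume.restrict A) + gagliardoEnergy s p A f ^ (1 / p)

/-- `f ∈ W^{s,p}(A ; F)`: `f` is measurable on `A`, its `W^{s,p}(A)` norm is finite, and `f` takes
values in `F` almost everywhere on `A`. -/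
def MemSobolev {n m : ℕ} (s p : ℝ) (A : Set (Fin n → ℝ)) (F : Set (EuclideanSpace ℝ (Fin m)))
    (f : (Fin n → ℝ) → EuclideanSpace ℝ (Fin m)) : Prop :=
  AEStronglyMeasurable f (volume.restrict A) ∧ sobolevNorm s p A f < ∞ ∧
    ∀ᵐ x ∂volume.restrict A, f x ∈ F

/-- A finite mesh in `ℝⁿ`: finitely many cubes `T + 2εK + [-ε, ε]ⁿ`, `K ∈ ℤⁿ`, of the horizontal
mesh of size `2ε` having `T` as one of its centers. -/
structure CubicMesh (n : ℕ) where
  T : Fin n → ℝ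
  ε : ℝ
  ε_pos : 0 < ε
  cubes : Finset (Fin n → ℤ)

namespace CubicMesh

variable {n : ℕ}

/-- The faces of the cube with index `K` are described by a vector of signs `σ`: the coordinates
with `σ i = 0` are free, while the others are frozen at the end point `± ε` (relative to the
center of the cube) given by `σ i`. This is the center of that face. -/
noncomputable def faceCenter (C : CubicMesh n) (K : Fin n → ℤ) (σ : Fin n → SignType) :
    Fin n → ℝ :=
  fun i => C.T i + 2 * C.ε * (K i : ℝ) + C.ε * ((σ i : SignType) : ℝ)

/-- The closed face of the cube with index `K` described by `σ`. -/
def face (C : CubicMesh n) (K : Fin n → ℤ) (σ : Fin n → SignType) : Set (Fin n → ℝ) :=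
  {x | ∀ i, |x i - C.faceCenter K σ i| ≤ C.ε ∧ (σ i ≠ 0 → x i = C.faceCenter K σ i)}

/-- The dimension of the faces described by `σ`: the number of free coordinates. -/
def faceDim (σ : Fin n → SignType) : ℕ := (Finset.univ.filter fun i => σ i = 0).card

/-- The `l`-dimensional skeleton: the union of the `l`-dimensional faces of the cubes. -/
def skeleton (C : CubicMesh n) (l : ℕ) : Set (Fin n → ℝ) :=
  {x | ∃ K ∈ C.cubes, ∃ σ : Fin n → SignType, faceDim σ = l ∧ x ∈ C.face K σ}

/-- The mesh as a subset of `ℝⁿ`: the union of its closed cubes. -/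
def carrier (C : CubicMesh n) : Set (Fin n → ℝ) :=
  {x | ∃ K ∈ C.cubes, ∀ i, |x i - (C.T i + 2 * C.ε * (K i : ℝ))| ≤ C.ε}

/-- `h` is, on the `l`-skeleton, the homogeneous extension of `g` from the `(l-1)`-skeleton: on each
`l`-dimensional face with center `z`, `h(x) = g (z + ε (x - z) / |x - z|)`, where `| |` is the sup
norm. The argument of `g` is the radial projection of `x` onto the relative boundary of the face;
as it is undefined at `x = z`, the value `h(z)` is not prescribed. -/
def IsHomogeneousStep {α : Type*} (C : CubicMesh n) (l : ℕ) (g h : (Fin n → ℝ) → α) : Prop :=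
  ∀ K ∈ C.cubes, ∀ σ : Fin n → SignType, faceDim σ = l → ∀ x ∈ C.face K σ,
    x ≠ C.faceCenter K σ →
      h x = g (C.faceCenter K σ + (C.ε / ‖x - C.faceCenter K σ‖) • (x - C.faceCenter K σ))

/-- `h` is, on the mesh, the `j`-homogeneous extension of the restriction of `g` to the
`j`-skeleton: it is obtained from `G j = g` by the `n - j` successive homogeneous extensions
`G (l + 1)` of `G l` from the `l`-skeleton to the `(l + 1)`-skeleton, `j ≤ l < n`. -/
def IsHomogeneousExtension {α : Type*} (C : CubicMesh n) (j : ℕ) (g h : (Fin n → ℝ) → α) :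
    Prop :=
  ∃ G : ℕ → (Fin n → ℝ) → α, EqOn (G j) g (C.skeleton j) ∧
    (∀ l, j ≤ l → l < n → C.IsHomogeneousStep (l + 1) (G l) (G (l + 1))) ∧
    EqOn (G n) h C.carrier

/-- `h` is piecewise `j`-homogeneous on the mesh: it is the `j`-homogeneous extension of its own
restriction to the `j`-skeleton. -/
def IsPiecewiseHomogeneous {α : Type*} (C : CubicMesh n) (j : ℕ) (h : (Fin n → ℝ) → α) : Prop :=
  C.IsHomogeneousExtension j h h

end CubicMesh

/-! The approximations are `f ∘ P`, where `P` is the successive radial retraction onto the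
`j`-skeleton of a mesh of cubes of side `δ`, with `δ → 0` and a well chosen translation `τ` of the
mesh. On the unit mesh `P` has a closed form: if `r` is the `(j+1)`-st smallest distance of a
coordinate to the integers, every coordinate is pushed away from its nearest integer by the factor
`1/(2r)`, stopping at the half-integers. At least `n - j` coordinates become half-integers when `r >
0`, and `P` is unchanged by radial scaling in any face of dimension greater than `j`
(`cellRetraction_scale`). This invariance gives the homogeneity.

The analytic point is that `P` is not bi-Lipschitz, so `f ∘ P` cannot be estimated by changing
variables for a fixed mesh. Averaging over `τ` cures this: by periodicity the position `z = x/δ + τ`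
in the cell becomes a variable independent of `x`. For fixed `z` and `h`, both `P x` and `P (x + h)`
are translates of `x` by fixed vectors, which differ by at most `min (|h|/r) (2δ)` with `r =
cellRadius j z` (`norm_cellRetraction_sub_le`). Such an increment is an average of smaller
increments (`setLIntegral_shift_le`), and integration in `h` against `|h|^{-q}`, `q = n + sp`, costs
a factor `r^{-sp}` (`lintegral_dilated_average_le`). The function `r^{-sp}` is integrable over the
cell exactly because `sp < j + 1`, which is where `[sp] ≤ j` enters.

Hence some `τ` bounds the norm of `f ∘ P - f` by the energy of `f` carried by pairs at distance less
than `4δ`, and this tends to `0` by absolute continuity of the integral. -/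

/-! ### Distance to the integers and the one-dimensional expansion. -/

/-- The distance of a real number to the nearest integer. -/
noncomputable def intDist (t : ℝ) : ℝ := |t - round t|

theorem intDist_nonneg (t : ℝ) : 0 ≤ intDist t := abs_nonneg _

theorem intDist_le_half (t : ℝ) : intDist t ≤ 1 / 2 := abs_sub_round t

theorem intDist_le (t : ℝ) (k : ℤ) : intDist t ≤ |t - k| := round_le t k

theorem abs_intDist_sub_le (t t' : ℝ) : |intDist t - intDist t'| ≤ |t - t'| := by
  have key : ∀ a b : ℝ, intDist a - intDist b ≤ |a - b| := fun a b => by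
    have h1 := intDist_le a (round b)
    have h2 : |a - round b| ≤ |a - b| + |b - round b| := abs_sub_le _ _ _
    unfold intDist at *
    linarith
  rw [abs_le]
  constructor
  · have := key t' t
    rw [abs_sub_comm] at this
    linarith
  · exact key t t'

/-- If `k` is one of the nearest integers of `t`, then it is the rounding of `t`, or `t` is a
half-integer at distance `1/2` of both. -/
theorem eq_round_or_half {t : ℝ} {k : ℤ} (h : |t - k| ≤ 1 / 2) :
    k = round t ∨ (|t - k| = 1 / 2 ∧ |t - round t| = 1 / 2) := by
  by_cases hk : k = round t
  · exact Or.inl hk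
  · right
    have h1 : (1 : ℝ) ≤ |(k : ℝ) - round t| := by
      have : (1 : ℤ) ≤ |k - round t| := Int.one_le_abs (sub_ne_zero.2 hk)
      exact_mod_cast this
    have h2 := abs_sub_round t
    have h3 : |(k : ℝ) - round t| ≤ |(k : ℝ) - t| + |t - round t| := abs_sub_le _ _ _
    rw [abs_sub_comm (k : ℝ) t] at h3
    constructor <;> linarith

theorem intDist_eq {t : ℝ} {k : ℤ} (h : |t - k| ≤ 1 / 2) : intDist t = |t - k| := by
  rcases eq_round_or_half h with rfl | ⟨h1, h2⟩
  · rfl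
  · rw [intDist, h1, h2]

theorem intDist_add_intCast (t : ℝ) (k : ℤ) : intDist (t + k) = intDist t := by
  simp [intDist]

/-- The map which expands the part of `ℝ` within `r` of an integer `k` to `[k - 1/2, k + 1/2]` and
sends the remaining points to the nearest half-integer. -/
noncomputable def pushOut (r t : ℝ) : ℝ :=
  round t + (t - round t) / (2 * max r |t - round t|)

theorem pushOut_add_intCast (r t : ℝ) (k : ℤ) : pushOut r (t + k) = pushOut r t + k := by
  simp [pushOut]
  ring

/-- The choice of nearest integer is immaterial: at a half-integer both formulas return `t`, because
`r ≤ 1/2` makes the maximum equal to `1/2`. -/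
theorem pushOut_eq {r t : ℝ} {k : ℤ} (hr : r ≤ 1 / 2) (h : |t - k| ≤ 1 / 2) :
    pushOut r t = k + (t - k) / (2 * max r |t - k|) := by
  rcases eq_round_or_half h with rfl | ⟨h1, h2⟩
  · rfl
  · rw [pushOut, h1, h2, max_eq_right hr]
    ring

theorem abs_div_two_max_le (r s : ℝ) : |s / (2 * max r |s|)| ≤ 1 / 2 := by
  rcases eq_or_ne s 0 with rfl | hs
  · simp
  · have h0 : 0 < |s| := abs_pos.2 hs
    have h1 : 0 < max r |s| := lt_of_lt_of_le h0 (le_max_right _ _)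
    rw [abs_div, abs_of_pos (by positivity : 0 < 2 * max r |s|), div_le_iff₀ (by positivity)]
    have := le_max_right r |s|
    linarith

theorem abs_pushOut_sub_self_le {r : ℝ} (hr : r ≤ 1 / 2) (t : ℝ) : |pushOut r t - t| ≤ 1 / 2 := by
  set s := t - round t with hs
  have hs2 : |s| ≤ 1 / 2 := abs_sub_round t
  have hq := abs_div_two_max_le r s
  have h1 : pushOut r t - t = s / (2 * max r |s|) - s := by
    rw [pushOut, hs]
    ring
  rw [h1]
  have hm : max r |s| ≤ 1 / 2 := max_le hr hs2
  have hm0 : 0 ≤ max r |s| := (abs_nonneg s).trans (le_max_right _ _)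
  rw [abs_le] at hq hs2 ⊢
  rcases le_total 0 s with h | h
  · have : 0 ≤ s / (2 * max r |s|) := by positivity
    constructor <;> linarith
  · have : s / (2 * max r |s|) ≤ 0 := div_nonpos_of_nonpos_of_nonneg h (by positivity)
    constructor <;> linarith

theorem div_two_max_eq {r : ℝ} (hr : 0 < r) (s : ℝ) :
    s / (2 * max r |s|) = max (-(1 / 2)) (min (1 / 2) (s / (2 * r))) := by
  rcases le_total |s| r with h | h
  · rw [max_eq_left h]
    have h' := abs_le.1 h
    rw [min_eq_right, max_eq_right]
    · rw [le_div_iff₀ (by positivity)]; linarith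
    · rw [div_le_iff₀ (by positivity)]; linarith
  · rw [max_eq_right h]
    rcases le_total 0 s with h0 | h0
    · rw [abs_of_nonneg h0] at h ⊢
      rw [min_eq_left, max_eq_right (by norm_num)]
      · have : 0 < s := lt_of_lt_of_le hr h
        field_simp
      · rw [le_div_iff₀ (by positivity)]; linarith
    · rw [abs_of_nonpos h0] at h ⊢
      have : s < 0 := by linarith
      rw [min_eq_right, max_eq_left]
      · rw [mul_neg, div_neg, mul_comm, div_mul_cancel_left₀ this.ne]
        norm_num
      · rw [div_le_iff₀ (by positivity)]; linarith
      · rw [div_le_iff₀ (by positivity)]; linarith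

theorem clamp_sub_le {a b : ℝ} (h : a ≤ b) :
    0 ≤ max (-(1 / 2)) (min (1 / 2) b) - max (-(1 / 2)) (min (1 / 2) a) ∧
      max (-(1 / 2)) (min (1 / 2) b) - max (-(1 / 2)) (min (1 / 2) a) ≤ b - a := by
  rcases le_total (1 / 2) b with h1 | h1 <;> rcases le_total (1 / 2) a with h2 | h2 <;>
  rcases le_total (-(1 / 2)) b with h3 | h3 <;> rcases le_total (-(1 / 2)) a with h4 | h4 <;>
  simp only [h1, h2, h3, h4, min_eq_left, min_eq_right, max_eq_right, max_eq_left] <;>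
  constructor <;> norm_num <;> linarith [h1, h2, h3, h4]

/-- Inside a cell the map is a clamped line of slope `1/(2r)`. Points in different cells are
compared through the half-integers between them, which are fixed, and `1 ≤ 1/(2r)` absorbs the
stretch in between. -/
theorem pushOut_sub_mem {r : ℝ} (hr : 0 < r) (hr2 : r ≤ 1 / 2) {t t' : ℝ} (h : t ≤ t') :
    0 ≤ pushOut r t' - pushOut r t ∧ pushOut r t' - pushOut r t ≤ (t' - t) / (2 * r) := by
  have same : ∀ (k : ℤ) (a b : ℝ), a ≤ b → |a - k| ≤ 1 / 2 → |b - k| ≤ 1 / 2 →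
      0 ≤ pushOut r b - pushOut r a ∧ pushOut r b - pushOut r a ≤ (b - a) / (2 * r) := by
    intro k a b hab ha hb
    rw [pushOut_eq hr2 ha, pushOut_eq hr2 hb, div_two_max_eq hr, div_two_max_eq hr]
    have hle : (a - k) / (2 * r) ≤ (b - k) / (2 * r) := by gcongr
    have := clamp_sub_le hle
    have e : (b - a) / (2 * r) = (b - k) / (2 * r) - (a - k) / (2 * r) := by ring
    rw [e]
    constructor <;> linarith [this.1, this.2]
  have fixHalf : ∀ (a : ℝ) (k : ℤ), |a - k| = 1 / 2 → pushOut r a = a := fun a k ha => by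
    rw [pushOut_eq hr2 ha.le, ha, max_eq_right hr2]
    ring
  have ht := abs_sub_round t
  have ht' := abs_sub_round t'
  by_cases hk : round t = round t'
  · exact same (round t) t t' h ht (hk ▸ ht')
  · have hab := abs_le.1 ht
    have hab' := abs_le.1 ht'
    have hlt : round t < round t' := by
      rcases lt_or_gt_of_ne hk with h1 | h1
      · exact h1
      · exfalso
        have h2 : (round t' : ℝ) + 1 ≤ round t := by exact_mod_cast h1
        have h3 : t = t' := by linarith
        exact hk (by rw [h3])
    have h2 : (round t : ℝ) + 1 ≤ round t' := by exact_mod_cast hlt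
    have A := same (round t) t (round t + 1 / 2) (by linarith) ht
      (by rw [abs_of_nonneg] <;> linarith)
    have B := same (round t') (round t' - 1 / 2) t' (by linarith)
      (by rw [abs_of_nonpos] <;> linarith) ht'
    rw [fixHalf (round t + 1 / 2) (round t) (by rw [abs_of_nonneg] <;> linarith)] at A
    rw [fixHalf (round t' - 1 / 2) (round t') (by rw [abs_of_nonpos] <;> linarith)] at B
    have C : (round t' - 1 / 2 - (round t + 1 / 2) : ℝ)
        ≤ (round t' - 1 / 2 - (round t + 1 / 2)) / (2 * r) := by
      rw [le_div_iff₀ (by positivity)]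
      have : (0 : ℝ) ≤ round t' - 1 / 2 - (round t + 1 / 2) := by linarith
      nlinarith
    have e : (t' - t) / (2 * r) = (t' - (round t' - 1 / 2)) / (2 * r) +
      (round t' - 1 / 2 - (round t + 1 / 2)) / (2 * r) + (round t + 1 / 2 - t) / (2 * r) := by ring
    rw [e]
    constructor <;> linarith [A.1, A.2, B.1, B.2]

theorem abs_pushOut_sub_le {r : ℝ} (hr : 0 < r) (hr2 : r ≤ 1 / 2) (t t' : ℝ) :
    |pushOut r t - pushOut r t'| ≤ |t - t'| / (2 * r) := by
  rcases le_total t t' with h | h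
  · have := pushOut_sub_mem hr hr2 h
    rw [abs_sub_comm, abs_of_nonneg this.1, abs_sub_comm, abs_of_nonneg (sub_nonneg.2 h)]
    exact this.2
  · have := pushOut_sub_mem hr hr2 h
    rw [abs_of_nonneg this.1, abs_of_nonneg (sub_nonneg.2 h)]
    exact this.2

/-- Only `r` has to be positive. This asymmetry later allows the radius at the second point to
vanish. -/
theorem abs_pushOut_radius_sub_le {r r' : ℝ} (hr : 0 < r) (t : ℝ) :
    |pushOut r t - pushOut r' t| ≤ |r - r'| / (2 * r) := by
  set s := t - round t with hs
  have e : pushOut r t - pushOut r' t = s / (2 * max r |s|) - s / (2 * max r' |s|) := by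
    rw [pushOut, pushOut, hs]
    ring
  rw [e]
  rcases eq_or_ne s 0 with h0 | h0
  · rw [h0]
    simp only [zero_div, sub_zero, abs_zero]
    positivity
  have hp : 0 < |s| := abs_pos.2 h0
  set M := max r |s| with hM
  set M' := max r' |s| with hM'
  have hM0 : 0 < M := lt_of_lt_of_le hr (le_max_left _ _)
  have hM0' : 0 < M' := lt_of_lt_of_le hp (le_max_right _ _)
  -- Factored so that the first factor is at most `1` whatever `r'` is, leaving only `M ≥ r` in the
  -- denominator.
  have e2 : s / (2 * M) - s / (2 * M') = (s / M') * ((M' - M) / (2 * M)) := by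
    field_simp
  have h1 : |s / M'| ≤ 1 := by
    rw [abs_div, abs_of_pos hM0', div_le_one hM0']
    exact le_max_right _ _
  have h2 : |M' - M| ≤ |r - r'| := by
    rw [abs_sub_comm r r']
    simpa using abs_max_sub_max_le_max r' |s| r |s|
  rw [e2, abs_mul, abs_div (M' - M), abs_of_pos (by positivity : 0 < 2 * M)]
  calc |s / M'| * (|M' - M| / (2 * M)) ≤ 1 * (|r - r'| / (2 * r)) := by
        gcongr
        exact le_max_left _ _
    _ = _ := one_mul _

/-! ### Retraction onto the skeleton of the unit mesh. -/

section Retraction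

variable {n : ℕ}

/-- The `(j+1)`-st smallest entry of a vector of nonnegative numbers. -/
noncomputable def orderStat (j : ℕ) (d : Fin n → ℝ) : ℝ :=
  ⨅ e : Fin (j + 1) ↪ Fin n, ‖d ∘ e‖

theorem orderStat_le {j : ℕ} (d : Fin n → ℝ) (e : Fin (j + 1) ↪ Fin n) :
    orderStat j d ≤ ‖d ∘ e‖ :=
  ciInf_le (Set.finite_range _).bddBelow e

theorem exists_orderStat_eq {j : ℕ} (hj : j < n) (d : Fin n → ℝ) :
    ∃ e : Fin (j + 1) ↪ Fin n, orderStat j d = ‖d ∘ e‖ := by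
  have : Nonempty (Fin (j + 1) ↪ Fin n) := ⟨Fin.castLEEmb hj⟩
  obtain ⟨e, he⟩ := exists_eq_ciInf_of_finite (f := fun e : Fin (j + 1) ↪ Fin n => ‖d ∘ e‖)
  exact ⟨e, he.symm⟩

theorem orderStat_nonneg (j : ℕ) (d : Fin n → ℝ) : 0 ≤ orderStat j d :=
  Real.iInf_nonneg fun _ => norm_nonneg _

theorem orderStat_le_of_le {j : ℕ} (hj : j < n) {d : Fin n → ℝ} {c : ℝ} (hd : ∀ i, |d i| ≤ c) :
    orderStat j d ≤ c :=
  (orderStat_le d (Fin.castLEEmb hj)).trans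
    ((pi_norm_le_iff_of_nonneg ((abs_nonneg _).trans (hd ⟨j, hj⟩))).2 fun _ => hd _)

theorem abs_orderStat_sub_le {j : ℕ} (hj : j < n) (d d' : Fin n → ℝ) :
    |orderStat j d - orderStat j d'| ≤ ‖d - d'‖ := by
  have key : ∀ a b : Fin n → ℝ, orderStat j a - orderStat j b ≤ ‖a - b‖ := fun a b => by
    obtain ⟨e, he⟩ := exists_orderStat_eq hj b
    have h1 := orderStat_le a e
    have h2 : ‖a ∘ e‖ - ‖b ∘ e‖ ≤ ‖a ∘ e - b ∘ e‖ := norm_sub_norm_le _ _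
    have h3 : ‖a ∘ e - b ∘ e‖ ≤ ‖a - b‖ :=
      (pi_norm_le_iff_of_nonneg (norm_nonneg _)).2 fun i => norm_le_pi_norm (a - b) (e i)
    linarith
  rw [abs_le]
  constructor
  · have := key d' d
    rw [norm_sub_rev] at this
    linarith
  · exact key d d'

/-- Scaling on a set `I` of at least `j + 1` coordinates, when the other entries are maximal. -/
theorem orderStat_le_mul {j : ℕ} (hj : j < n) {d d' : Fin n → ℝ} {c t : ℝ} (ht : 0 < t)
    {I : Finset (Fin n)} (hI : j < I.card) (hd : ∀ i, |d i| ≤ c) (hdI : ∀ i ∉ I, |d i| = c)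
    (hI' : ∀ i ∈ I, d' i = t * d i) : orderStat j d' ≤ t * orderStat j d := by
  obtain ⟨e, he⟩ := exists_orderStat_eq hj d
  have hex : ∃ e' : Fin (j + 1) ↪ Fin n, (∀ i, e' i ∈ I) ∧ ‖d ∘ e'‖ ≤ orderStat j d := by
    -- If the minimizing choice uses a coordinate outside `I`, its value is already the maximal `c`,
    -- so any `j + 1` coordinates of `I` do at least as well.
    by_cases h : ∀ i, e i ∈ I
    · exact ⟨e, h, he.ge⟩
    · push Not at h
      obtain ⟨i, hi⟩ := h
      have hc : c ≤ orderStat j d := by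
        rw [he, ← hdI _ hi]
        exact norm_le_pi_norm (d ∘ e) i
      let g := (Fin.castLEEmb (show j + 1 ≤ I.card from hI)).trans (I.orderEmbOfFin rfl).toEmbedding
      refine ⟨g, fun i => Finset.orderEmbOfFin_mem I rfl _, le_trans ?_ hc⟩
      exact (pi_norm_le_iff_of_nonneg ((abs_nonneg _).trans (hd (e i)))).2 fun i => hd _
  obtain ⟨e', h1, h2⟩ := hex
  calc orderStat j d' ≤ ‖d' ∘ e'‖ := orderStat_le _ _
    _ = ‖t • (d ∘ e')‖ := by
        congr 1
        ext i
        simp [hI' _ (h1 i)]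
    _ = t * ‖d ∘ e'‖ := by rw [norm_smul, Real.norm_of_nonneg ht.le]
    _ ≤ _ := by gcongr

/-- The `(j+1)`-st smallest distance of a coordinate to the integers. -/
noncomputable def cellRadius (j : ℕ) (z : Fin n → ℝ) : ℝ :=
  orderStat j fun i => intDist (z i)

/-- The retraction of `ℝⁿ` (away from the dual skeleton) onto the `j`-skeleton of the mesh of unit
cubes centered at the points of `ℤⁿ`, obtained by successive radial projections. -/
noncomputable def cellRetraction (j : ℕ) (z : Fin n → ℝ) : Fin n → ℝ :=
  fun i => pushOut (cellRadius j z) (z i)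

theorem cellRadius_nonneg (j : ℕ) (z : Fin n → ℝ) : 0 ≤ cellRadius j z := orderStat_nonneg _ _

theorem abs_intDist_le_half (t : ℝ) : |intDist t| ≤ 1 / 2 := by
  rw [abs_of_nonneg (intDist_nonneg t)]
  exact intDist_le_half t

theorem cellRadius_le_half {j : ℕ} (hj : j < n) (z : Fin n → ℝ) : cellRadius j z ≤ 1 / 2 :=
  orderStat_le_of_le hj fun _ => abs_intDist_le_half _

theorem abs_cellRadius_sub_le {j : ℕ} (hj : j < n) (z z' : Fin n → ℝ) :
    |cellRadius j z - cellRadius j z'| ≤ ‖z - z'‖ :=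
  (abs_orderStat_sub_le hj _ _).trans <| (pi_norm_le_iff_of_nonneg (norm_nonneg _)).2 fun i =>
    (abs_intDist_sub_le _ _).trans (norm_le_pi_norm (z - z') i)

theorem norm_cellRetraction_sub_self_le {j : ℕ} (hj : j < n) (z : Fin n → ℝ) :
    ‖cellRetraction j z - z‖ ≤ 1 / 2 :=
  (pi_norm_le_iff_of_nonneg (by norm_num)).2 fun i =>
    abs_pushOut_sub_self_le (cellRadius_le_half hj z) (z i)

/-- Moving the point at fixed radius and moving the radius (a 1-Lipschitz function) each contribute
`1/(2r)`. Only the radius at `z` appears, so `z` can be frozen while `z'` varies freely. -/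
theorem norm_cellRetraction_sub_le {j : ℕ} (hj : j < n) {z : Fin n → ℝ} (hz : 0 < cellRadius j z)
    (z' : Fin n → ℝ) :
    ‖cellRetraction j z' - cellRetraction j z‖ ≤ ‖z' - z‖ / cellRadius j z := by
  refine (pi_norm_le_iff_of_nonneg (by positivity)).2 fun i => ?_
  have h1 := abs_pushOut_sub_le hz (cellRadius_le_half hj z) (z' i) (z i)
  have h2 := abs_pushOut_radius_sub_le (r' := cellRadius j z') hz (z' i)
  have h3 : |z' i - z i| ≤ ‖z' - z‖ := norm_le_pi_norm (z' - z) i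
  have h4 := abs_cellRadius_sub_le hj z z'
  rw [norm_sub_rev] at h4
  rw [abs_sub_comm] at h2
  set r := cellRadius j z
  set r' := cellRadius j z'
  change |pushOut r' (z' i) - pushOut r (z i)| ≤ _
  calc |pushOut r' (z' i) - pushOut r (z i)|
      ≤ |pushOut r' (z' i) - pushOut r (z' i)| + |pushOut r (z' i) - pushOut r (z i)| :=
        abs_sub_le _ _ _
    _ ≤ ‖z' - z‖ / (2 * r) + ‖z' - z‖ / (2 * r) := by
        refine add_le_add (h2.trans ?_) (h1.trans ?_) <;> gcongr
    _ = _ := by ring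

theorem cellRadius_add_intCast (j : ℕ) (z : Fin n → ℝ) (k : Fin n → ℤ) :
    cellRadius j (fun i => z i + k i) = cellRadius j z := by
  simp [cellRadius, intDist_add_intCast]

theorem cellRetraction_add_intCast (j : ℕ) (z : Fin n → ℝ) (k : Fin n → ℤ) :
    cellRetraction j (fun i => z i + k i) = fun i => cellRetraction j z i + k i := by
  ext i
  simp only [cellRetraction, cellRadius_add_intCast, pushOut_add_intCast]

theorem measurable_cellRadius {j : ℕ} (hj : j < n) :
    Measurable (cellRadius j : (Fin n → ℝ) → ℝ) := by
  have : LipschitzWith 1 (cellRadius j : (Fin n → ℝ) → ℝ) :=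
    LipschitzWith.of_dist_le_mul fun x y => by
      simpa [dist_eq_norm] using abs_cellRadius_sub_le hj x y
  exact this.continuous.measurable

theorem measurable_round_real : Measurable (fun t : ℝ => (round t : ℝ)) := by
  have h : (fun t : ℝ => (round t : ℝ)) = fun t => ((⌊t + 1 / 2⌋ : ℤ) : ℝ) := by
    ext t
    rw [round_eq]
  rw [h]
  fun_prop

theorem measurable_cellRetraction {j : ℕ} (hj : j < n) :
    Measurable (cellRetraction j : (Fin n → ℝ) → Fin n → ℝ) := by
  refine measurable_pi_lambda _ fun i => ?_
  have h1 := measurable_cellRadius (n := n) hj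
  have h2 : Measurable fun z : Fin n → ℝ => (round (z i) : ℝ) :=
    measurable_round_real.comp (measurable_pi_apply i)
  unfold cellRetraction pushOut
  have h3 : Measurable fun z : Fin n → ℝ => z i - round (z i) := (measurable_pi_apply i).sub h2
  exact h2.add (h3.div ((h1.max h3.abs).const_mul 2))

/-- The retraction is invariant under radial scaling on a face of dimension larger than `j`. -/
theorem cellRetraction_scale {j : ℕ} (hj : j < n) {z z' : Fin n → ℝ} {k : Fin n → ℤ}
    {I : Finset (Fin n)} (hI : j < I.card) {t : ℝ} (ht : 0 < t)
    (hz : ∀ i, |z i - k i| ≤ 1 / 2) (hz' : ∀ i, |z' i - k i| ≤ 1 / 2)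
    (hzI : ∀ i ∉ I, |z i - k i| = 1 / 2) (hI' : ∀ i ∉ I, z' i = z i)
    (hzt : ∀ i ∈ I, z' i - k i = t * (z i - k i)) :
    cellRetraction j z' = cellRetraction j z := by
  have hd : ∀ i, intDist (z i) = |z i - k i| := fun i => intDist_eq (hz i)
  have hd' : ∀ i, intDist (z' i) = |z' i - k i| := fun i => intDist_eq (hz' i)
  have h1 : cellRadius j z' ≤ t * cellRadius j z := by
    refine orderStat_le_mul hj ht hI (fun _ => abs_intDist_le_half _) (fun i hi => ?_)
      (fun i hi => ?_)
    · rw [hd, abs_abs, hzI i hi]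
    · rw [hd, hd', hzt i hi, abs_mul, abs_of_pos ht]
  have h2 : cellRadius j z ≤ t⁻¹ * cellRadius j z' := by
    refine orderStat_le_mul hj (inv_pos.2 ht) hI (fun _ => abs_intDist_le_half _) (fun i hi => ?_)
      (fun i hi => ?_)
    · rw [hd', abs_abs, hI' i hi, hzI i hi]
    · rw [hd, hd', hzt i hi, abs_mul, abs_of_pos ht, inv_mul_cancel_left₀ ht.ne']
  have hr : cellRadius j z' = t * cellRadius j z := by
    refine le_antisymm h1 ?_
    rwa [inv_mul_eq_div, le_div_iff₀ ht, mul_comm] at h2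
  have hr1 := cellRadius_le_half hj z
  have hr2 := cellRadius_le_half hj z'
  ext i
  simp only [cellRetraction]
  rw [pushOut_eq hr1 (hz i), pushOut_eq hr2 (hz' i)]
  by_cases hi : i ∈ I
  · rw [hzt i hi, hr, abs_mul, abs_of_pos ht, ← mul_max_of_nonneg _ _ ht.le]
    congr 1
    rw [← mul_assoc, mul_comm 2 t, mul_assoc, mul_div_mul_left _ _ ht.ne']
  · rw [hI' i hi, hzI i hi, max_eq_right hr1, max_eq_right hr2]

end Retraction

/-! ### Periodic averages, power integrals, integrability of the inverse radius. -/

section Averaging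

variable {n : ℕ}

/-- The half-open unit box of `ℝⁿ`. -/
def unitBox (n : ℕ) : Set (Fin n → ℝ) := univ.pi fun _ => Ico 0 1

theorem measurableSet_unitBox : MeasurableSet (unitBox n) :=
  MeasurableSet.univ_pi fun _ => measurableSet_Ico

theorem volume_unitBox : volume (unitBox n) = 1 := by
  rw [unitBox, volume_pi, Measure.pi_pi]
  simp

instance isProbabilityMeasure_restrict_unitBox :
    IsProbabilityMeasure (volume.restrict (unitBox n)) :=
  ⟨by rw [Measure.restrict_apply_univ, volume_unitBox]⟩

open scoped Pointwise in
/-- The mean over the unit box of a `ℤⁿ`-periodic function is translation invariant. -/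
theorem setLIntegral_unitBox_add {g : (Fin n → ℝ) → ℝ≥0∞}
    (hg : ∀ (z : Fin n → ℝ) (k : Fin n → ℤ), g (fun i => z i + k i) = g z) (a : Fin n → ℝ) :
    ∫⁻ τ in unitBox n, g (a + τ) = ∫⁻ z in unitBox n, g z := by
  set b := Pi.basisFun ℝ (Fin n) with hb
  have hQ : unitBox n = ZSpan.fundamentalDomain b :=
    (ZSpan.fundamentalDomain_pi_basisFun).symm
  have h1 : IsAddFundamentalDomain (Submodule.span ℤ (Set.range b)) (unitBox n) volume := by
    rw [hQ]
    exact ZSpan.isAddFundamentalDomain b volume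
  have h2 := h1.vadd_of_comm a
  have hper : ∀ (v : Submodule.span ℤ (Set.range b)) (x : Fin n → ℝ), g (v +ᵥ x) = g x := by
    rintro ⟨v, hv⟩ x
    have hv' := (Module.Basis.mem_span_iff_repr_mem ℤ b v).1 hv
    choose k hk using hv'
    have : (⟨v, hv⟩ : Submodule.span ℤ (Set.range b)) +ᵥ x = fun i => x i + k i := by
      ext i
      have := hk i
      simp only [hb, Pi.basisFun_repr] at this
      change v i + x i = _
      rw [← this, add_comm]
      simp
    rw [this, hg]
  have : VAddInvariantMeasure (Submodule.span ℤ (Set.range b)) (Fin n → ℝ) volume :=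
    ⟨fun v s _ => measure_preimage_add volume (v : Fin n → ℝ) s⟩
  rw [← h2.setLIntegral_eq h1 g hper]
  have e : unitBox n = (fun τ => a + τ) ⁻¹' (a +ᵥ unitBox n) := by
    ext τ
    rw [mem_preimage, ← vadd_eq_add, vadd_mem_vadd_set_iff]
  conv_lhs => rw [e]
  exact (measurePreserving_add_left volume a).setLIntegral_comp_preimage_emb
    (measurableEmbedding_addLeft a) g _

theorem lintegral_comp_const_smul {a : ℝ} (ha : 0 < a) {g : (Fin n → ℝ) → ℝ≥0∞}
    (hg : Measurable g) :
    ∫⁻ h, g h = ENNReal.ofReal a ^ (n : ℝ) * ∫⁻ h, g (a • h) := by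
  rw [← lintegral_map hg (measurable_const_smul a), Measure.map_addHaar_smul _ ha.ne',
    lintegral_smul_measure, smul_eq_mul, ← mul_assoc]
  have : ENNReal.ofReal a ^ (n : ℝ) * ENNReal.ofReal |(a ^ Module.finrank ℝ (Fin n → ℝ))⁻¹| = 1 := by
    rw [Module.finrank_fin_fun, abs_of_pos (by positivity), ENNReal.rpow_natCast,
      ← ENNReal.ofReal_pow ha.le, ← ENNReal.ofReal_mul (by positivity), mul_inv_cancel₀ (by positivity)]
    simp
  rw [this, one_mul]

theorem enorm_eq_ofReal_norm' (x : Fin n → ℝ) : ‖x‖ₑ = ENNReal.ofReal ‖x‖ := (ofReal_norm x).symm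

theorem lintegral_inv_enorm_rpow_lt_top {q : ℝ} (hq : (n : ℝ) < q) :
    ∫⁻ h in {h : Fin n → ℝ | 1 ≤ ‖h‖}, (‖h‖ₑ ^ q)⁻¹ < ∞ := by
  have hq0 : 0 < q := lt_of_le_of_lt (Nat.cast_nonneg n) hq
  have hi : Integrable (fun x : Fin n → ℝ => (1 + ‖x‖) ^ (-q)) volume :=
    integrable_one_add_norm (by simpa using hq)
  have hi' := (hi.const_mul ((2 : ℝ) ^ q)).lintegral_lt_top
  refine lt_of_le_of_lt ?_ hi'
  refine (setLIntegral_mono' (measurableSet_le measurable_const measurable_norm) fun h hh => ?_).trans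
    (setLIntegral_le_lintegral _ _)
  have h1 : (1 : ℝ) ≤ ‖h‖ := hh
  have h0 : 0 < ‖h‖ := by linarith
  rw [enorm_eq_ofReal_norm', ENNReal.ofReal_rpow_of_pos h0, ← ENNReal.ofReal_inv_of_pos (by positivity)]
  apply ENNReal.ofReal_le_ofReal
  rw [Real.rpow_neg (by positivity), ← div_eq_mul_inv, ← Real.div_rpow (by norm_num) (by positivity),
    ← Real.inv_rpow h0.le]
  apply Real.rpow_le_rpow (by positivity) _ hq0.le
  rw [le_div_iff₀ (by positivity), inv_mul_le_iff₀ h0]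
  linarith

theorem measurable_inv_enorm_rpow (q : ℝ) :
    Measurable fun h : Fin n → ℝ => (‖h‖ₑ ^ q)⁻¹ := by fun_prop

theorem measurableSet_le_norm (a : ℝ) : MeasurableSet {h : Fin n → ℝ | a ≤ ‖h‖} :=
  measurableSet_le measurable_const measurable_norm

/-- Scaling `h ↦ a • h`. It is used with `a = δ` for distant pairs and with `a = r|k|/2` for dilated
increments. -/
theorem setLIntegral_inv_enorm_rpow_eq {q : ℝ} {a : ℝ} (ha : 0 < a) :
    ∫⁻ h in {h : Fin n → ℝ | a ≤ ‖h‖}, (‖h‖ₑ ^ q)⁻¹ =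
      ENNReal.ofReal a ^ ((n : ℝ) - q) * ∫⁻ h in {h : Fin n → ℝ | 1 ≤ ‖h‖}, (‖h‖ₑ ^ q)⁻¹ := by
  have hA0 : ENNReal.ofReal a ≠ 0 := by simpa using ha
  have hA1 : ENNReal.ofReal a ≠ ∞ := ENNReal.ofReal_ne_top
  rw [← lintegral_indicator (measurableSet_le_norm a),
    lintegral_comp_const_smul ha ((measurable_inv_enorm_rpow q).indicator (measurableSet_le_norm a)),
    ENNReal.rpow_sub _ _ hA0 hA1, div_eq_mul_inv, mul_assoc,
    ← lintegral_const_mul _ (measurable_inv_enorm_rpow q),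
    ← lintegral_indicator (measurableSet_le_norm 1)]
  congr 2
  ext h
  simp only [indicator_apply, mem_ofPred_eq, norm_smul, Real.norm_of_nonneg ha.le,
    le_mul_iff_one_le_right ha]
  split_ifs
  · rw [enorm_smul, Real.enorm_of_nonneg ha.le, ENNReal.mul_rpow_of_ne_top hA1 (by simp),
      ENNReal.mul_inv (Or.inl (by simp [hA0])) (Or.inl (by simp [hA0]))]
  · rfl

theorem ae_ne_zero_pi (hn : 0 < n) : ∀ᵐ h : Fin n → ℝ, h ≠ 0 := by
  have : Nonempty (Fin n) := ⟨⟨0, hn⟩⟩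
  simp [ae_iff]

/-- On the unit interval the distance is the smaller of `t` and `1 - t`, so its power is at most `t
^ (-b) + (1 - t) ^ (-b)`. -/
theorem integrableOn_intDist_rpow {b : ℝ} (hb : b < 1) :
    IntegrableOn (fun t => intDist t ^ (-b)) (Ico 0 1) := by
  have h1 : IntegrableOn (fun t : ℝ => t ^ (-b)) (Ioo 0 1) :=
    (((intervalIntegral.intervalIntegrable_rpow' (a := 0) (b := 1) (r := -b) (by linarith)).1).mono_set
      Ioo_subset_Ioc_self)
  have h2 : IntegrableOn (fun t : ℝ => (1 - t) ^ (-b)) (Ioo 0 1) := by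
    have := (intervalIntegral.intervalIntegrable_rpow' (a := 0) (b := 1) (r := -b)
      (by linarith)).comp_sub_left 1
    have := this.symm.1
    simp only [sub_zero, sub_self] at this
    exact this.mono_set Ioo_subset_Ioc_self
  rw [integrableOn_Ico_iff_integrableOn_Ioo]
  refine Integrable.mono' (h1.add h2) ?_ ?_
  · have : Measurable intDist := (measurable_id.sub measurable_round_real).abs
    exact (this.pow_const _).aestronglyMeasurable
  · refine (ae_restrict_iff' measurableSet_Ioo).2 (Eventually.of_forall fun t ht => ?_)
    have ht0 : 0 < t := ht.1
    have ht1 : 0 < 1 - t := by linarith [ht.2]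
    rw [Real.norm_of_nonneg (Real.rpow_nonneg (intDist_nonneg t) _), Pi.add_apply]
    have A : 0 ≤ t ^ (-b) := by positivity
    have B : 0 ≤ (1 - t) ^ (-b) := by positivity
    rcases le_total t (1 / 2) with h | h
    · have : intDist t = t := by
        rw [intDist_eq (k := 0) (by rw [abs_of_nonneg] <;> simp <;> linarith)]
        simp [abs_of_pos ht0]
      rw [this]
      linarith
    · have : intDist t = 1 - t := by
        rw [intDist_eq (k := 1) (by rw [abs_of_nonpos] <;> simp <;> linarith), abs_sub_comm]
        simp [abs_of_pos ht1]
      rw [this]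
      linarith

theorem setLIntegral_prod_intDist_lt_top {b : ℝ} (hb : b < 1) :
    ∫⁻ z in unitBox n, ∏ i, ENNReal.ofReal (intDist (z i)) ^ (-b) < ∞ := by
  have h := Integrable.fintype_prod (ι := Fin n) (f := fun _ (t : ℝ) => intDist t ^ (-b))
    (μ := fun _ => (volume : Measure ℝ).restrict (Ico 0 1))
    (fun _ => integrableOn_intDist_rpow hb)
  rw [← Measure.restrict_pi_pi] at h
  refine lt_of_le_of_lt (le_of_eq ?_) h.lintegral_lt_top
  refine lintegral_congr_ae ?_
  have hne : ∀ᵐ z : Fin n → ℝ, ∀ i, z i ≠ 0 :=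
    ae_all_iff.2 fun i => Measure.ae_eval_ne (μ := fun _ => (volume : Measure ℝ)) i 0
  filter_upwards [ae_restrict_of_ae hne, ae_restrict_mem measurableSet_unitBox] with z hz hzQ
  rw [ENNReal.ofReal_prod_of_nonneg fun i _ => Real.rpow_nonneg (intDist_nonneg _) _]
  refine Finset.prod_congr rfl fun i _ => ENNReal.ofReal_rpow_of_pos ?_
  refine lt_of_le_of_ne (intDist_nonneg _) fun h0 => hz i ?_
  have h1 : z i = round (z i) := by
    have := abs_eq_zero.1 h0.symm
    linarith
  have h2 := hzQ i (mem_univ i)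
  have h3 : (round (z i) : ℝ) < 1 := h1 ▸ h2.2
  have h4 : (0 : ℝ) ≤ round (z i) := h1 ▸ h2.1
  have h5 : round (z i) = 0 := by
    have a1 : round (z i) < 1 := by exact_mod_cast h3
    have a2 : 0 ≤ round (z i) := by exact_mod_cast h4
    omega
  rw [h1, h5, Int.cast_zero]

/-- The `j + 1` smallest distances are all at most the radius, so `r^{-a}` splits evenly among them.
The remaining factors are at least `1`. The product separates the variables and reduces
integrability to the one-dimensional condition `a/(j+1) < 1`. -/
theorem ofReal_cellRadius_rpow_le {j : ℕ} (hj : j < n) {a : ℝ} (ha : 0 ≤ a) (z : Fin n → ℝ) :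
    ENNReal.ofReal (cellRadius j z) ^ (-a) ≤
      ∏ i, ENNReal.ofReal (intDist (z i)) ^ (-(a / ((j : ℝ) + 1))) := by
  obtain ⟨e, he⟩ := exists_orderStat_eq hj fun i => intDist (z i)
  have hj0 : (0 : ℝ) < (j : ℝ) + 1 := by positivity
  set b := a / ((j : ℝ) + 1) with hb
  have hb0 : 0 ≤ b := by positivity
  have hanti : ∀ x y : ℝ≥0∞, x ≤ y → y ^ (-b) ≤ x ^ (-b) := fun x y h => by
    rw [ENNReal.rpow_neg, ENNReal.rpow_neg, ENNReal.inv_le_inv]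
    exact ENNReal.rpow_le_rpow h hb0
  calc ENNReal.ofReal (cellRadius j z) ^ (-a)
      = ∏ _i : Fin (j + 1), ENNReal.ofReal (cellRadius j z) ^ (-b) := by
        rw [Finset.prod_const, Finset.card_univ, Fintype.card_fin, ← ENNReal.rpow_natCast,
          ← ENNReal.rpow_mul]
        congr 1
        push_cast
        rw [hb]
        field_simp
    _ ≤ ∏ i : Fin (j + 1), ENNReal.ofReal (intDist (z (e i))) ^ (-b) := by
        refine Finset.prod_le_prod' fun i _ => hanti _ _ (ENNReal.ofReal_le_ofReal ?_)
        rw [cellRadius, he]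
        exact (le_abs_self _).trans (norm_le_pi_norm ((fun i => intDist (z i)) ∘ e) i)
    _ = ∏ i ∈ Finset.univ.map e, ENNReal.ofReal (intDist (z i)) ^ (-b) := by
        rw [Finset.prod_map]
    _ ≤ _ := by
        refine Finset.prod_le_prod_of_subset_of_one_le' (Finset.subset_univ _) fun i _ _ => ?_
        have h1 : ENNReal.ofReal (intDist (z i)) ≤ 1 := by
          rw [← ENNReal.ofReal_one]
          exact ENNReal.ofReal_le_ofReal ((intDist_le_half _).trans (by norm_num))
        simpa using hanti _ _ h1

theorem setLIntegral_cellRadius_rpow_lt_top {j : ℕ} (hj : j < n) {a : ℝ} (ha : 0 ≤ a)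
    (haj : a < (j : ℝ) + 1) :
    ∫⁻ z in unitBox n, ENNReal.ofReal (cellRadius j z) ^ (-a) < ∞ :=
  lt_of_le_of_lt (lintegral_mono fun z => ofReal_cellRadius_rpow_le hj ha z)
    (setLIntegral_prod_intDist_lt_top ((div_lt_one (by positivity)).2 haj))

/-- A negative power of the radius is integrable, hence finite almost everywhere, while `0 ^
(-(1/2)) = ∞`. Any exponent strictly between `0` and `j + 1` would serve. -/
theorem ae_cellRadius_pos {j : ℕ} (hj : j < n) :
    ∀ᵐ z ∂volume.restrict (unitBox n), 0 < cellRadius j z := by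
  have h := ae_lt_top ((measurable_cellRadius hj).ennreal_ofReal.pow_const (-(1 / 2 : ℝ)))
    (setLIntegral_cellRadius_rpow_lt_top hj (a := 1 / 2) (by norm_num)
      (by have : (0 : ℝ) ≤ j := Nat.cast_nonneg j
          linarith)).ne
  filter_upwards [h] with z hz
  refine lt_of_le_of_ne (cellRadius_nonneg j z) fun h0 => ?_
  rw [← h0] at hz
  simp at hz

end Averaging

/-! ### Increments of two-point functions and their averages. -/

section Increments

variable {n : ℕ}

/-- The total size of the increments `W x (x + k)` with step `k` of a two-point function `W`. -/
noncomputable def totalIncrement (W : (Fin n → ℝ) → (Fin n → ℝ) → ℝ≥0∞) (k : Fin n → ℝ) : ℝ≥0∞ :=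
  ∫⁻ x, W x (x + k)

/-- The part of the energy of `W` coming from pairs of points at distance less than `R`. -/
noncomputable def localEnergy (W : (Fin n → ℝ) → (Fin n → ℝ) → ℝ≥0∞) (q R : ℝ) : ℝ≥0∞ :=
  ∫⁻ k in Metric.ball 0 R, totalIncrement W k * (‖k‖ₑ ^ q)⁻¹

variable {W : (Fin n → ℝ) → (Fin n → ℝ) → ℝ≥0∞}

theorem measurable_totalIncrement (hW : Measurable (Function.uncurry W)) :
    Measurable (totalIncrement W) := by
  have : Measurable fun q : (Fin n → ℝ) × (Fin n → ℝ) => W q.2 (q.2 + q.1) :=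
    hW.comp (measurable_snd.prodMk (measurable_snd.add measurable_fst))
  exact this.lintegral_prod_right

theorem localEnergy_mono {q R R' : ℝ} (h : R ≤ R') : localEnergy W q R ≤ localEnergy W q R' :=
  lintegral_mono_set (Metric.ball_subset_ball h)

theorem setLIntegral_totalIncrement_le (hn : 0 < n) {q R : ℝ} (hq : 0 ≤ q) :
    ∫⁻ k in Metric.ball 0 R, totalIncrement W k ≤ ENNReal.ofReal R ^ q * localEnergy W q R := by
  rw [localEnergy, ← lintegral_const_mul']
  · refine lintegral_mono_ae ?_
    filter_upwards [ae_restrict_of_ae (ae_ne_zero_pi hn),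
      ae_restrict_mem Metric.isOpen_ball.measurableSet] with k hk hkR
    have hk0 : ‖k‖ₑ ^ q ≠ 0 := by
      simp [hk, ENNReal.rpow_eq_zero_iff]
    have hk1 : ‖k‖ₑ ^ q ≠ ∞ := ENNReal.rpow_ne_top_of_nonneg hq (by simp)
    calc totalIncrement W k = ‖k‖ₑ ^ q * (totalIncrement W k * (‖k‖ₑ ^ q)⁻¹) := by
          rw [mul_left_comm, ENNReal.mul_inv_cancel hk0 hk1, mul_one]
      _ ≤ _ := by
          gcongr
          rw [enorm_eq_ofReal_norm']
          exact ENNReal.ofReal_le_ofReal (mem_ball_zero_iff.1 hkR).le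
  · exact ENNReal.rpow_ne_top_of_nonneg hq ENNReal.ofReal_ne_top

/-- Comparison of one increment with the average of the small ones. -/
theorem setLIntegral_shift_le (hW : Measurable (Function.uncurry W)) {ω A : Set (Fin n → ℝ)}
    {M : ℝ≥0∞} (htri : ∀ x y, ∀ v ∈ ω, W x y ≤ M * (W x v + W v y)) (hA : MeasurableSet A)
    {a b : Fin n → ℝ} {ρ : ℝ} (hρ : 0 < ρ) (hab : ‖b - a‖ ≤ ρ)
    (hAω : ∀ x ∈ A, ∀ w, ‖w‖ < ρ → x + a + w ∈ ω) :
    ∫⁻ x in A, W (x + a) (x + b) ≤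
      2 * M * ENNReal.ofReal ρ ^ (-(n : ℝ)) *
        ∫⁻ k in Metric.ball 0 (2 * ρ), totalIncrement W k := by
  set B : Set (Fin n → ℝ) := Metric.ball 0 ρ with hB
  have hBm : MeasurableSet B := Metric.isOpen_ball.measurableSet
  have hD := measurable_totalIncrement hW
  have hWc : ∀ {f g : (Fin n → ℝ) → Fin n → ℝ}, Measurable f → Measurable g →
      Measurable fun x => W (f x) (g x) := fun hf hg => hW.comp (hf.prodMk hg)
  -- The sup-norm ball has volume `(2ρ)^n`; the factor `2^n` is discarded.
  have hvol : ENNReal.ofReal ρ ^ (n : ℝ) ≤ volume B := by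
    rw [hB, Real.volume_pi_ball _ hρ, Fintype.card_fin, ENNReal.rpow_natCast,
      ← ENNReal.ofReal_pow hρ.le]
    apply ENNReal.ofReal_le_ofReal
    gcongr
    linarith
  -- The quasi-triangle inequality is applied through `v = x + a + w`. After translation in `x` the
  -- two halves are increments with steps `w` and `b - a - w`, both shorter than `2ρ`; then `w` is
  -- averaged over the ball.
  have step : ∀ w ∈ B, ∫⁻ x in A, W (x + a) (x + b) ≤
      M * (totalIncrement W w + totalIncrement W ((b - a) - w)) := fun w hw => by
    have e1 : totalIncrement W w = ∫⁻ x, W (x + a) (x + a + w) := by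
      rw [totalIncrement, ← lintegral_add_right_eq_self _ a]
    have e2 : totalIncrement W ((b - a) - w) = ∫⁻ x, W (x + a + w) (x + b) := by
      rw [totalIncrement, ← lintegral_add_right_eq_self _ (a + w)]
      congr 1
      ext x
      congr 1 <;> abel
    rw [e1, e2, ← lintegral_add_left (hWc (by fun_prop) (by fun_prop)), ← lintegral_const_mul]
    · refine (setLIntegral_mono' hA fun x hx => ?_).trans (setLIntegral_le_lintegral A _)
      exact htri _ _ _ (hAω x hx w (mem_ball_zero_iff.1 hw))
    · exact (hWc (by fun_prop) (by fun_prop)).add (hWc (by fun_prop) (by fun_prop))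
  have i1 : ∫⁻ w in B, totalIncrement W w ≤
      ∫⁻ k in Metric.ball 0 (2 * ρ), totalIncrement W k :=
    lintegral_mono_set (Metric.ball_subset_ball (by linarith))
  have i2 : ∫⁻ w in B, totalIncrement W ((b - a) - w) ≤
      ∫⁻ k in Metric.ball 0 (2 * ρ), totalIncrement W k := by
    rw [← lintegral_indicator hBm,
      ← lintegral_indicator (s := Metric.ball 0 (2 * ρ)) Metric.isOpen_ball.measurableSet,
      ← lintegral_sub_left_eq_self ((Metric.ball 0 (2 * ρ)).indicator _) (b - a)]
    refine lintegral_mono fun w => ?_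
    by_cases hw : w ∈ B
    · rw [indicator_of_mem hw, indicator_of_mem]
      rw [mem_ball_zero_iff] at hw ⊢
      have := norm_sub_le (b - a) w
      linarith
    · rw [indicator_of_notMem hw]
      exact zero_le
  have hmain : ENNReal.ofReal ρ ^ (n : ℝ) * ∫⁻ x in A, W (x + a) (x + b) ≤
      2 * M * ∫⁻ k in Metric.ball 0 (2 * ρ), totalIncrement W k := by
    calc ENNReal.ofReal ρ ^ (n : ℝ) * ∫⁻ x in A, W (x + a) (x + b)
        ≤ volume B * ∫⁻ x in A, W (x + a) (x + b) := by gcongr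
      _ = ∫⁻ _w in B, ∫⁻ x in A, W (x + a) (x + b) := by
          rw [setLIntegral_const, mul_comm]
      _ ≤ ∫⁻ w in B, M * (totalIncrement W w + totalIncrement W ((b - a) - w)) :=
          setLIntegral_mono' hBm step
      _ = M * ((∫⁻ w in B, totalIncrement W w) + ∫⁻ w in B, totalIncrement W ((b - a) - w)) := by
          rw [lintegral_const_mul, lintegral_add_left hD]
          exact hD.add (hD.comp (by fun_prop))
      _ ≤ M * ((∫⁻ k in Metric.ball 0 (2 * ρ), totalIncrement W k) +
            ∫⁻ k in Metric.ball 0 (2 * ρ), totalIncrement W k) := by gcongr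
      _ = _ := by ring
  have h0 : ENNReal.ofReal ρ ^ (n : ℝ) ≠ 0 := by simp [hρ]
  have h1 : ENNReal.ofReal ρ ^ (n : ℝ) ≠ ∞ := by simp
  rw [mul_right_comm, ENNReal.rpow_neg, ← div_eq_mul_inv,
    ENNReal.le_div_iff_mul_le (Or.inl h0) (Or.inl h1), mul_comm]
  exact hmain

/-- The increments of `W` with step of the same size as the scale are controlled by the energy. -/
theorem setLIntegral_shift_le_localEnergy (hn : 0 < n) (hW : Measurable (Function.uncurry W))
    {ω A : Set (Fin n → ℝ)} {M : ℝ≥0∞} (htri : ∀ x y, ∀ v ∈ ω, W x y ≤ M * (W x v + W v y))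
    (hA : MeasurableSet A) {b : Fin n → ℝ} {ρ q : ℝ} (hρ : 0 < ρ) (hq : 0 ≤ q) (hb : ‖b‖ ≤ ρ)
    (hAω : ∀ x ∈ A, ∀ w, ‖w‖ < ρ → x + w ∈ ω) :
    ∫⁻ x in A, W x (x + b) ≤
      2 * M * 2 ^ q * ENNReal.ofReal ρ ^ (q - n) * localEnergy W q (2 * ρ) := by
  have h := setLIntegral_shift_le hW htri hA (a := 0) (b := b) hρ (by simpa using hb)
    (by simpa using hAω)
  simp only [add_zero] at h
  refine h.trans ?_
  have h0 : ENNReal.ofReal ρ ≠ 0 := by simpa using hρ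
  calc _ ≤ 2 * M * ENNReal.ofReal ρ ^ (-(n : ℝ)) *
        (ENNReal.ofReal (2 * ρ) ^ q * localEnergy W q (2 * ρ)) := by
        gcongr
        exact setLIntegral_totalIncrement_le hn hq
    _ = _ := by
        rw [ENNReal.ofReal_mul (by norm_num), ENNReal.mul_rpow_of_nonneg _ _ hq,
          sub_eq_neg_add, ENNReal.rpow_add _ _ h0 ENNReal.ofReal_ne_top, ENNReal.ofReal_ofNat]
        ring

/-- The energy integral of averaged increments, at a point where the dilation is at most `1 / r`. -/
theorem lintegral_dilated_average_le (hn : 0 < n) (hW : Measurable (Function.uncurry W))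
    {q r δ : ℝ} (hq : (n : ℝ) < q) (hr : 0 < r) :
    ∫⁻ h : Fin n → ℝ, (‖h‖ₑ ^ q)⁻¹ * (ENNReal.ofReal (min (‖h‖ / r) (2 * δ)) ^ (-(n : ℝ)) *
        ∫⁻ k in Metric.ball 0 (2 * min (‖h‖ / r) (2 * δ)), totalIncrement W k) ≤
      (∫⁻ h in {h : Fin n → ℝ | 1 ≤ ‖h‖}, (‖h‖ₑ ^ q)⁻¹) * 2 ^ q *
        ENNReal.ofReal r ^ ((n : ℝ) - q) * localEnergy W q (4 * δ) := by
  have hD := measurable_totalIncrement hW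
  set c := ∫⁻ h in {h : Fin n → ℝ | 1 ≤ ‖h‖}, (‖h‖ₑ ^ q)⁻¹ with hc
  -- A majorant with separated domains: `|k| < 2ρ` gives `|k| < 4δ`, `|h| ≥ r|k|/2` and `ρ^{-n} ≤
  -- (|k|/2)^{-n}`. Integrating first in `h` yields a multiple of `(r|k|/2)^{n-q}`, and the powers
  -- of `|k|/2` combine to `2^q |k|^{-q}`.
  set G : (Fin n → ℝ) → (Fin n → ℝ) → ℝ≥0∞ := fun h k =>
    {h : Fin n → ℝ | r * ‖k‖ / 2 ≤ ‖h‖}.indicator (fun h => (‖h‖ₑ ^ q)⁻¹) h *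
      (Metric.ball (0 : Fin n → ℝ) (4 * δ)).indicator
        (fun k => ENNReal.ofReal (‖k‖ / 2) ^ (-(n : ℝ)) * totalIncrement W k) k with hG
  have hGm : Measurable (Function.uncurry G) := by
    have e : Function.uncurry G = fun p : (Fin n → ℝ) × (Fin n → ℝ) =>
        {p : (Fin n → ℝ) × (Fin n → ℝ) | r * ‖p.2‖ / 2 ≤ ‖p.1‖}.indicator
          (fun p => (‖p.1‖ₑ ^ q)⁻¹) p *
        (Metric.ball (0 : Fin n → ℝ) (4 * δ)).indicator
          (fun k => ENNReal.ofReal (‖k‖ / 2) ^ (-(n : ℝ)) * totalIncrement W k) p.2 := by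
      ext ⟨h, k⟩
      rfl
    rw [e]
    refine Measurable.mul (Measurable.indicator (by fun_prop)
      (measurableSet_le (by fun_prop) (by fun_prop))) ?_
    refine (Measurable.indicator ?_ Metric.isOpen_ball.measurableSet).comp measurable_snd
    exact Measurable.mul (by fun_prop) hD
  have hle : ∀ h : Fin n → ℝ,
      (‖h‖ₑ ^ q)⁻¹ * (ENNReal.ofReal (min (‖h‖ / r) (2 * δ)) ^ (-(n : ℝ)) *
        ∫⁻ k in Metric.ball 0 (2 * min (‖h‖ / r) (2 * δ)), totalIncrement W k) ≤
      ∫⁻ k, G h k := fun h => by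
    set ρ := min (‖h‖ / r) (2 * δ) with hρ
    rw [← lintegral_indicator Metric.isOpen_ball.measurableSet, ← lintegral_const_mul _
      (hD.indicator Metric.isOpen_ball.measurableSet), ← lintegral_const_mul _
      ((hD.indicator Metric.isOpen_ball.measurableSet).const_mul _)]
    refine lintegral_mono fun k => ?_
    by_cases hk : k ∈ Metric.ball (0 : Fin n → ℝ) (2 * ρ)
    · rw [mem_ball_zero_iff] at hk
      have m1 : ρ ≤ ‖h‖ / r := min_le_left _ _
      have m2 : ρ ≤ 2 * δ := min_le_right _ _
      have k1 : k ∈ Metric.ball (0 : Fin n → ℝ) (4 * δ) := by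
        rw [mem_ball_zero_iff]; linarith
      have k2 : h ∈ {h : Fin n → ℝ | r * ‖k‖ / 2 ≤ ‖h‖} := by
        change r * ‖k‖ / 2 ≤ ‖h‖
        have := (le_div_iff₀ hr).1 m1
        nlinarith
      simp only [hG]
      rw [indicator_of_mem k1, indicator_of_mem k2, indicator_of_mem (mem_ball_zero_iff.2 hk)]
      refine mul_le_mul' le_rfl (mul_le_mul' ?_ le_rfl)
      rw [ENNReal.rpow_neg, ENNReal.rpow_neg, ENNReal.inv_le_inv]
      refine ENNReal.rpow_le_rpow (ENNReal.ofReal_le_ofReal (by linarith)) (Nat.cast_nonneg n)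
    · rw [indicator_of_notMem hk]
      simp
  refine (lintegral_mono hle).trans ?_
  rw [lintegral_lintegral_swap hGm.aemeasurable, localEnergy,
    ← lintegral_indicator Metric.isOpen_ball.measurableSet, ← lintegral_const_mul]
  · refine lintegral_mono_ae ?_
    filter_upwards [ae_ne_zero_pi hn] with k hk
    have hk0 : 0 < ‖k‖ := norm_pos_iff.2 hk
    simp only [hG]
    rw [lintegral_mul_const _ ((measurable_inv_enorm_rpow q).indicator (measurableSet_le_norm _)),
      lintegral_indicator (measurableSet_le_norm _),
      setLIntegral_inv_enorm_rpow_eq (by positivity), ← hc]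
    by_cases hkb : k ∈ Metric.ball (0 : Fin n → ℝ) (4 * δ)
    · rw [indicator_of_mem hkb, indicator_of_mem hkb]
      have e0 : ENNReal.ofReal (‖k‖ / 2) ≠ 0 := by simpa using hk
      have e1 : r * ‖k‖ / 2 = r * (‖k‖ / 2) := by ring
      have e2 : ENNReal.ofReal (‖k‖ / 2) ^ ((n : ℝ) - q) * ENNReal.ofReal (‖k‖ / 2) ^ (-(n : ℝ)) =
          2 ^ q * (‖k‖ₑ ^ q)⁻¹ := by
        rw [← ENNReal.rpow_add _ _ e0 ENNReal.ofReal_ne_top, sub_add_eq_add_sub, add_neg_cancel,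
          zero_sub, enorm_eq_ofReal_norm', ENNReal.rpow_neg,
          ENNReal.ofReal_div_of_pos (by norm_num), ENNReal.div_rpow_of_nonneg _ _
            ((Nat.cast_nonneg n).trans hq.le), ENNReal.ofReal_ofNat, ENNReal.inv_div, div_eq_mul_inv]
        · exact Or.inl (by simp)
        · exact Or.inl (by simp)
      rw [e1, ENNReal.ofReal_mul hr.le, ENNReal.mul_rpow_of_ne_top ENNReal.ofReal_ne_top
        ENNReal.ofReal_ne_top]
      apply le_of_eq
      calc _ = c * ENNReal.ofReal r ^ ((n : ℝ) - q) * totalIncrement W k *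
            (ENNReal.ofReal (‖k‖ / 2) ^ ((n : ℝ) - q) * ENNReal.ofReal (‖k‖ / 2) ^ (-(n : ℝ))) := by
            ring
        _ = _ := by
            rw [e2]
            ring
    · rw [indicator_of_notMem hkb, indicator_of_notMem hkb]
      simp
  · exact (hD.mul (measurable_inv_enorm_rpow q)).indicator Metric.isOpen_ball.measurableSet

end Increments

/-! ### Retractions of fine meshes, averaged over translations. -/

section MeshRetraction

variable {n : ℕ}

/-- The displacement of the retraction onto the `j`-skeleton of the unit mesh. -/
noncomputable def cellShift (j : ℕ) (z : Fin n → ℝ) : Fin n → ℝ := cellRetraction j z - z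

theorem cellShift_add_intCast (j : ℕ) (z : Fin n → ℝ) (k : Fin n → ℤ) :
    cellShift j (fun i => z i + k i) = cellShift j z := by
  ext i
  simp [cellShift, cellRetraction_add_intCast]

theorem measurable_cellShift {j : ℕ} (hj : j < n) :
    Measurable (cellShift j : (Fin n → ℝ) → Fin n → ℝ) :=
  (measurable_cellRetraction hj).sub measurable_id

theorem norm_cellShift_le {j : ℕ} (hj : j < n) (z : Fin n → ℝ) : ‖cellShift j z‖ ≤ 1 / 2 :=
  norm_cellRetraction_sub_self_le hj z

/-- The retraction onto the `j`-skeleton of the mesh of cubes of side `δ` centered at the points of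
`δ (ℤⁿ - τ)`. -/
noncomputable def meshRetraction (j : ℕ) (δ : ℝ) (τ x : Fin n → ℝ) : Fin n → ℝ :=
  x + δ • cellShift j (δ⁻¹ • x + τ)

theorem measurable_meshRetraction {j : ℕ} (hj : j < n) (δ : ℝ) :
    Measurable (Function.uncurry (meshRetraction j δ) :
      (Fin n → ℝ) × (Fin n → ℝ) → Fin n → ℝ) := by
  have h := (measurable_cellShift (n := n) hj).comp
    (f := fun p : (Fin n → ℝ) × (Fin n → ℝ) => δ⁻¹ • p.2 + p.1) (by fun_prop)
  exact measurable_snd.add (h.const_smul δ)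

theorem norm_meshRetraction_sub_self_le {j : ℕ} (hj : j < n) {δ : ℝ} (hδ : 0 < δ)
    (τ x : Fin n → ℝ) : ‖meshRetraction j δ τ x - x‖ ≤ δ / 2 := by
  rw [meshRetraction, add_sub_cancel_left, norm_smul, Real.norm_of_nonneg hδ.le]
  have := norm_cellShift_le hj (δ⁻¹ • x + τ)
  nlinarith

/-- Averaging over the translations of the mesh. -/
theorem lintegral_unitBox_average {g : (Fin n → ℝ) → (Fin n → ℝ) → ℝ≥0∞}
    (hg : Measurable (Function.uncurry g))
    (hper : ∀ x z, ∀ k : Fin n → ℤ, g x (fun i => z i + k i) = g x z) (A : Set (Fin n → ℝ))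
    (a : ℝ) :
    ∫⁻ τ in unitBox n, ∫⁻ x in A, g x (a • x + τ) = ∫⁻ z in unitBox n, ∫⁻ x in A, g x z := by
  rw [lintegral_lintegral_swap (f := fun τ x => g x (a • x + τ)),
    lintegral_lintegral_swap (f := fun z x => g x z)]
  · refine lintegral_congr fun x => ?_
    exact setLIntegral_unitBox_add (hper x) _
  · exact (hg.comp measurable_swap).aemeasurable
  · exact (hg.comp (f := fun p : (Fin n → ℝ) × (Fin n → ℝ) => (p.2, a • p.2 + p.1))
      (by fun_prop)).aemeasurable

variable {W : (Fin n → ℝ) → (Fin n → ℝ) → ℝ≥0∞}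

/-- The energy of the pairs of points at distance less than `δ` after transport by `P`. -/
noncomputable def nearEnergy (W : (Fin n → ℝ) → (Fin n → ℝ) → ℝ≥0∞) (q δ : ℝ)
    (A : Set (Fin n → ℝ)) (P : (Fin n → ℝ) → Fin n → ℝ) : ℝ≥0∞ :=
  ∫⁻ x in A, ∫⁻ h in Metric.ball 0 δ, W (P x) (P (x + h)) * (‖h‖ₑ ^ q)⁻¹

/-- For a frozen cell position `z` the displacement is a fixed vector of length at most `δ/2`, so
the shift estimate applies with a bound uniform in `z`. -/
theorem lintegral_displacement_le (hW : Measurable (Function.uncurry W))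
    {ω A : Set (Fin n → ℝ)} {M : ℝ≥0∞} (htri : ∀ x y, ∀ v ∈ ω, W x y ≤ M * (W x v + W v y))
    (hA : MeasurableSet A) {j : ℕ} (hj : j < n) {q δ : ℝ} (hq : 0 ≤ q) (hδ : 0 < δ)
    (hAω : ∀ x ∈ A, ∀ w, ‖w‖ < 4 * δ → x + w ∈ ω) :
    ∫⁻ τ in unitBox n, ∫⁻ x in A, W x (meshRetraction j δ τ x) ≤
      2 * M * 2 ^ q * ENNReal.ofReal δ ^ (q - n) * localEnergy W q (4 * δ) := by
  have hs := measurable_cellShift (n := n) hj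
  have hm : Measurable (Function.uncurry fun (x z : Fin n → ℝ) => W x (x + δ • cellShift j z)) :=
    hW.comp (measurable_fst.prodMk
      (measurable_fst.add ((hs.comp measurable_snd).const_smul δ)))
  have h1 := lintegral_unitBox_average hm (fun x z k => by simp only [cellShift_add_intCast]) A δ⁻¹
  simp only [meshRetraction]
  rw [h1]
  have h2 : ∀ z, ∫⁻ x in A, W x (x + δ • cellShift j z) ≤
      2 * M * 2 ^ q * ENNReal.ofReal δ ^ (q - n) * localEnergy W q (4 * δ) := fun z => by
    refine (setLIntegral_shift_le_localEnergy (by omega) hW htri hA hδ hq ?_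
      fun x hx w hw => hAω x hx w (by linarith)).trans ?_
    · rw [norm_smul, Real.norm_of_nonneg hδ.le]
      have := norm_cellShift_le hj z
      nlinarith
    · gcongr
      exact localEnergy_mono (by linarith)
  refine (lintegral_mono h2).trans ?_
  rw [setLIntegral_const, volume_unitBox, mul_one]

/-- With `z` frozen, both images are `x` plus vectors depending only on `z` and `h`. Their distance
is at most the dilation `1/r` times `|h|`, so the energy is lost only by the factor `r^{n-q}`,
integrated over the cell at the end. -/
theorem lintegral_nearEnergy_le (hW : Measurable (Function.uncurry W))
    {ω A : Set (Fin n → ℝ)} {M : ℝ≥0∞} (htri : ∀ x y, ∀ v ∈ ω, W x y ≤ M * (W x v + W v y))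
    (hA : MeasurableSet A) {j : ℕ} (hj : j < n) {q δ : ℝ} (hq : (n : ℝ) < q) (hδ : 0 < δ)
    (hAω : ∀ x ∈ A, ∀ w, ‖w‖ < 4 * δ → x + w ∈ ω) :
    ∫⁻ τ in unitBox n, nearEnergy W q δ A (meshRetraction j δ τ) ≤
      (∫⁻ z in unitBox n, ENNReal.ofReal (cellRadius j z) ^ ((n : ℝ) - q)) *
        (2 * M * (∫⁻ h in {h : Fin n → ℝ | 1 ≤ ‖h‖}, (‖h‖ₑ ^ q)⁻¹) * 2 ^ q *
          localEnergy W q (4 * δ)) := by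
  have hs := measurable_cellShift (n := n) hj
  set c := ∫⁻ h in {h : Fin n → ℝ | 1 ≤ ‖h‖}, (‖h‖ₑ ^ q)⁻¹
  set H : (Fin n → ℝ) → (Fin n → ℝ) → (Fin n → ℝ) → ℝ≥0∞ := fun x z h =>
    W (x + δ • cellShift j z) (x + (h + δ • cellShift j (z + δ⁻¹ • h))) * (‖h‖ₑ ^ q)⁻¹ with hH
  have hHm : Measurable fun p : ((Fin n → ℝ) × (Fin n → ℝ)) × (Fin n → ℝ) => H p.1.1 p.1.2 p.2 := by
    refine Measurable.mul (hW.comp (Measurable.prodMk ?_ ?_)) (by fun_prop)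
    · exact (measurable_fst.comp measurable_fst).add
        ((hs.comp (measurable_snd.comp measurable_fst)).const_smul δ)
    · refine (measurable_fst.comp measurable_fst).add (measurable_snd.add (Measurable.const_smul ?_ δ))
      exact hs.comp (f := fun p : ((Fin n → ℝ) × (Fin n → ℝ)) × (Fin n → ℝ) => p.1.2 + δ⁻¹ • p.2)
        (by fun_prop)
  have hGm : Measurable (Function.uncurry fun x z => ∫⁻ h in Metric.ball 0 δ, H x z h) :=
    hHm.lintegral_prod_right'
  have hper : ∀ x z, ∀ k : Fin n → ℤ, ∫⁻ h in Metric.ball 0 δ, H x (fun i => z i + k i) h =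
      ∫⁻ h in Metric.ball 0 δ, H x z h := fun x z k => by
    refine lintegral_congr fun h => ?_
    have : (fun i => z i + (k i : ℝ)) + δ⁻¹ • h = fun i => (z + δ⁻¹ • h) i + k i := by
      ext i
      simp only [Pi.add_apply]
      ring
    simp only [hH]
    rw [this, cellShift_add_intCast, cellShift_add_intCast]
  have e : ∀ τ, nearEnergy W q δ A (meshRetraction j δ τ) =
      ∫⁻ x in A, ∫⁻ h in Metric.ball 0 δ, H x (δ⁻¹ • x + τ) h := fun τ => by
    rw [nearEnergy]
    refine lintegral_congr fun x => lintegral_congr fun h => ?_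
    simp only [hH, meshRetraction]
    rw [smul_add, add_assoc x h, add_right_comm (δ⁻¹ • x) τ]
  simp only [e]
  rw [lintegral_unitBox_average hGm hper, ← lintegral_mul_const _
    ((measurable_cellRadius hj).ennreal_ofReal.pow_const _)]
  refine lintegral_mono_ae ?_
  filter_upwards [ae_cellRadius_pos hj] with z hz
  set r := cellRadius j z
  rw [lintegral_lintegral_swap (f := fun x h => H x z h)
    (hHm.comp (f := fun p : (Fin n → ℝ) × (Fin n → ℝ) => ((p.1, z), p.2)) (by fun_prop)).aemeasurable]
  have hinner : ∀ᵐ h ∂volume.restrict (Metric.ball (0 : Fin n → ℝ) δ), ∫⁻ x in A, H x z h ≤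
      2 * M * ((‖h‖ₑ ^ q)⁻¹ * (ENNReal.ofReal (min (‖h‖ / r) (2 * δ)) ^ (-(n : ℝ)) *
        ∫⁻ k in Metric.ball 0 (2 * min (‖h‖ / r) (2 * δ)), totalIncrement W k)) := by
    filter_upwards [ae_restrict_of_ae (ae_ne_zero_pi (by omega : 0 < n)),
      ae_restrict_mem Metric.isOpen_ball.measurableSet] with h hh hhδ
    rw [mem_ball_zero_iff] at hhδ
    have hh0 : 0 < ‖h‖ := norm_pos_iff.2 hh
    have b1 := norm_cellShift_le hj z
    have b2 := norm_cellShift_le hj (z + δ⁻¹ • h)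
    have n1 : ‖δ • cellShift j z‖ ≤ δ / 2 := by
      rw [norm_smul, Real.norm_of_nonneg hδ.le]; nlinarith
    have n2 : ‖δ • cellShift j (z + δ⁻¹ • h)‖ ≤ δ / 2 := by
      rw [norm_smul, Real.norm_of_nonneg hδ.le]; nlinarith
    -- The bound `|h|/r` is the dilation estimate; `2δ` is `|h| < δ` plus two displacements of at
    -- most `δ/2`. The second bound keeps all points inside `ω` even where `r` is small.
    have hab : ‖(h + δ • cellShift j (z + δ⁻¹ • h)) - δ • cellShift j z‖ ≤
        min (‖h‖ / r) (2 * δ) := by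
      refine le_min ?_ ?_
      · have e1 : (h + δ • cellShift j (z + δ⁻¹ • h)) - δ • cellShift j z =
            δ • (cellRetraction j (z + δ⁻¹ • h) - cellRetraction j z) := by
          simp only [cellShift, smul_sub, smul_add, smul_inv_smul₀ hδ.ne']
          abel
        rw [e1, norm_smul, Real.norm_of_nonneg hδ.le]
        have := norm_cellRetraction_sub_le hj hz (z + δ⁻¹ • h)
        rw [add_sub_cancel_left, norm_smul, norm_inv, Real.norm_of_nonneg hδ.le] at this
        calc _ ≤ δ * (δ⁻¹ * ‖h‖ / r) := by gcongr
          _ = _ := by field_simp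
      · have := norm_sub_le (h + δ • cellShift j (z + δ⁻¹ • h)) (δ • cellShift j z)
        have := norm_add_le h (δ • cellShift j (z + δ⁻¹ • h))
        linarith
    have hρ : 0 < min (‖h‖ / r) (2 * δ) := by positivity
    have hfin : (‖h‖ₑ ^ q)⁻¹ ≠ ∞ := by
      have : ‖h‖ₑ ^ q ≠ 0 := by simp [hh, ENNReal.rpow_eq_zero_iff]
      simpa using this
    simp only [hH]
    rw [lintegral_mul_const' _ _ hfin]
    calc _ ≤ (2 * M * ENNReal.ofReal (min (‖h‖ / r) (2 * δ)) ^ (-(n : ℝ)) *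
          ∫⁻ k in Metric.ball 0 (2 * min (‖h‖ / r) (2 * δ)), totalIncrement W k) *
            (‖h‖ₑ ^ q)⁻¹ := by
          gcongr
          refine setLIntegral_shift_le hW htri hA hρ hab fun x hx w hw => ?_
          rw [add_assoc]
          refine hAω x hx _ ((norm_add_le _ _).trans_lt ?_)
          have := min_le_right (‖h‖ / r) (2 * δ)
          linarith
      _ = _ := by ring
  calc ∫⁻ h in Metric.ball 0 δ, ∫⁻ x in A, H x z h
      ≤ ∫⁻ h in Metric.ball (0 : Fin n → ℝ) δ, 2 * M * ((‖h‖ₑ ^ q)⁻¹ *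
          (ENNReal.ofReal (min (‖h‖ / r) (2 * δ)) ^ (-(n : ℝ)) *
          ∫⁻ k in Metric.ball 0 (2 * min (‖h‖ / r) (2 * δ)), totalIncrement W k)) :=
        lintegral_mono_ae hinner
    _ ≤ ∫⁻ h : Fin n → ℝ, 2 * M * ((‖h‖ₑ ^ q)⁻¹ *
          (ENNReal.ofReal (min (‖h‖ / r) (2 * δ)) ^ (-(n : ℝ)) *
          ∫⁻ k in Metric.ball 0 (2 * min (‖h‖ / r) (2 * δ)), totalIncrement W k)) :=
        setLIntegral_le_lintegral _ _
    _ = 2 * M * ∫⁻ h : Fin n → ℝ, ((‖h‖ₑ ^ q)⁻¹ *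
          (ENNReal.ofReal (min (‖h‖ / r) (2 * δ)) ^ (-(n : ℝ)) *
          ∫⁻ k in Metric.ball 0 (2 * min (‖h‖ / r) (2 * δ)), totalIncrement W k)) := by
        refine lintegral_const_mul _ ?_
        have hball : Measurable fun h : Fin n → ℝ =>
            ∫⁻ k in Metric.ball 0 (2 * min (‖h‖ / r) (2 * δ)), totalIncrement W k := by
          have hs' : MeasurableSet {p : (Fin n → ℝ) × (Fin n → ℝ) |
              ‖p.2‖ < 2 * min (‖p.1‖ / r) (2 * δ)} :=
            measurableSet_lt (by fun_prop) (by fun_prop)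
          have := (((measurable_totalIncrement hW).comp measurable_snd).indicator
            hs').lintegral_prod_right' (ν := (volume : Measure (Fin n → ℝ)))
          convert this using 1
          ext h
          rw [← lintegral_indicator Metric.isOpen_ball.measurableSet]
          refine lintegral_congr fun k => ?_
          by_cases hk : ‖k‖ < 2 * min (‖h‖ / r) (2 * δ)
          · rw [indicator_of_mem (mem_ball_zero_iff.2 hk), indicator_of_mem (by exact hk)]
            rfl
          · rw [indicator_of_notMem (fun h' => hk (mem_ball_zero_iff.1 h')),
              indicator_of_notMem (by exact hk)]
        exact Measurable.mul (by fun_prop) (Measurable.mul (by fun_prop) hball)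
    _ ≤ 2 * M * (c * 2 ^ q * ENNReal.ofReal r ^ ((n : ℝ) - q) * localEnergy W q (4 * δ)) := by
        gcongr
        exact lintegral_dilated_average_le (by omega) hW hq hz
    _ = _ := by ring

/-- For a suitable translation of the mesh, the displacement and the near energy of the
retraction onto the `j`-skeleton are controlled by the local energy. -/
theorem exists_meshRetraction_energy_le (hW : Measurable (Function.uncurry W))
    {ω : Set (Fin n → ℝ)} {M : ℝ≥0∞} (hM : M ≠ ∞)
    (htri : ∀ x y, ∀ v ∈ ω, W x y ≤ M * (W x v + W v y))
    {j : ℕ} (hj : j < n) {q : ℝ} (hq : (n : ℝ) < q) (hqj : q - n < (j : ℝ) + 1) :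
    ∃ B : ℝ≥0∞, B ≠ ∞ ∧ ∀ (δ : ℝ), 0 < δ → ∀ (A : Set (Fin n → ℝ)), MeasurableSet A →
      (∀ x ∈ A, ∀ w, ‖w‖ < 4 * δ → x + w ∈ ω) → ∃ τ : Fin n → ℝ,
        ENNReal.ofReal δ ^ ((n : ℝ) - q) * (∫⁻ x in A, W x (meshRetraction j δ τ x)) +
          nearEnergy W q δ A (meshRetraction j δ τ) ≤ B * localEnergy W q (4 * δ) := by
  have hq0 : 0 ≤ q := (Nat.cast_nonneg n).trans hq.le
  have hc := (lintegral_inv_enorm_rpow_lt_top hq).ne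
  have hI : ∫⁻ z in unitBox n, ENNReal.ofReal (cellRadius j z) ^ ((n : ℝ) - q) ≠ ∞ := by
    have := (setLIntegral_cellRadius_rpow_lt_top hj (sub_nonneg.2 hq.le) hqj).ne
    rwa [neg_sub] at this
  have h2q : (2 : ℝ≥0∞) ^ q ≠ ∞ := ENNReal.rpow_ne_top_of_nonneg hq0 (by simp)
  set c := ∫⁻ h in {h : Fin n → ℝ | 1 ≤ ‖h‖}, (‖h‖ₑ ^ q)⁻¹
  set I := ∫⁻ z in unitBox n, ENNReal.ofReal (cellRadius j z) ^ ((n : ℝ) - q)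
  refine ⟨2 * M * 2 ^ q + I * (2 * M * c * 2 ^ q), ?_, fun δ hδ A hA hAω => ?_⟩
  · finiteness
  have hP := measurable_meshRetraction (n := n) hj δ
  have hm1 : Measurable fun τ => ∫⁻ x in A, W x (meshRetraction j δ τ x) :=
    Measurable.lintegral_prod_right' (f := fun p => W p.2 (meshRetraction j δ p.1 p.2))
      (hW.comp (measurable_snd.prodMk hP))
  have hm2 : Measurable fun τ => nearEnergy W q δ A (meshRetraction j δ τ) := by
    refine Measurable.lintegral_prod_right' (f := fun p : (Fin n → ℝ) × (Fin n → ℝ) =>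
      ∫⁻ h in Metric.ball 0 δ, W (meshRetraction j δ p.1 p.2) (meshRetraction j δ p.1 (p.2 + h)) *
        (‖h‖ₑ ^ q)⁻¹) ?_
    refine Measurable.lintegral_prod_right' (f := fun p : ((Fin n → ℝ) × (Fin n → ℝ)) × (Fin n → ℝ) =>
      W (meshRetraction j δ p.1.1 p.1.2) (meshRetraction j δ p.1.1 (p.1.2 + p.2)) *
        (‖p.2‖ₑ ^ q)⁻¹) ?_
    refine Measurable.mul (hW.comp (Measurable.prodMk (hP.comp measurable_fst) ?_)) (by fun_prop)
    exact hP.comp (f := fun p : ((Fin n → ℝ) × (Fin n → ℝ)) × (Fin n → ℝ) =>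
      (p.1.1, p.1.2 + p.2)) (by fun_prop)
  -- The box is a probability space, so some `τ` does not exceed the mean. Taking the mean of the
  -- sum makes one `τ` serve both terms.
  obtain ⟨τ, hτ⟩ := exists_le_lintegral (μ := volume.restrict (unitBox n))
    ((hm1.const_mul (ENNReal.ofReal δ ^ ((n : ℝ) - q))).add hm2).aemeasurable
  refine ⟨τ, hτ.trans ?_⟩
  simp only [Pi.add_apply]
  rw [lintegral_add_right _ hm2, lintegral_const_mul _ hm1, add_mul]
  have hδ0 : ENNReal.ofReal δ ≠ 0 := by simpa using hδ
  refine add_le_add ?_ ((lintegral_nearEnergy_le hW htri hA hj hq hδ hAω).trans_eq (by ring))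
  calc _ ≤ ENNReal.ofReal δ ^ ((n : ℝ) - q) *
        (2 * M * 2 ^ q * ENNReal.ofReal δ ^ (q - n) * localEnergy W q (4 * δ)) := by
        gcongr
        exact lintegral_displacement_le hW htri hA hj hq0 hδ hAω
    _ = 2 * M * 2 ^ q * localEnergy W q (4 * δ) *
        (ENNReal.ofReal δ ^ ((n : ℝ) - q) * ENNReal.ofReal δ ^ (q - n)) := by ring
    _ = _ := by
        rw [← ENNReal.rpow_add _ _ hδ0 ENNReal.ofReal_ne_top]
        simp

end MeshRetraction

/-! ### The Gagliardo energy in terms of increments. -/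

section Energy

variable {n m : ℕ}

/-- The numerator of the Gagliardo energy on `ω`, as a two-point function. -/
noncomputable def pairEnergy (p : ℝ) (ω : Set (Fin n → ℝ))
    (f : (Fin n → ℝ) → EuclideanSpace ℝ (Fin m)) (x y : Fin n → ℝ) : ℝ≥0∞ :=
  (ω ×ˢ ω).indicator (fun a => ‖f a.1 - f a.2‖ₑ ^ p) (x, y)

variable {p : ℝ} {ω : Set (Fin n → ℝ)} {f : (Fin n → ℝ) → EuclideanSpace ℝ (Fin m)}

theorem pairEnergy_of_mem {x y : Fin n → ℝ} (hx : x ∈ ω) (hy : y ∈ ω) :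
    pairEnergy p ω f x y = ‖f x - f y‖ₑ ^ p :=
  indicator_of_mem (mk_mem_prod hx hy) _

theorem measurable_pairEnergy (hω : MeasurableSet ω) (hf : Measurable f) :
    Measurable (Function.uncurry (pairEnergy p ω f)) := by
  change Measurable ((ω ×ˢ ω).indicator fun a => ‖f a.1 - f a.2‖ₑ ^ p)
  exact Measurable.indicator (by fun_prop) (hω.prod hω)

theorem enorm_add_rpow_le {E : Type*} [NormedAddCommGroup E] (hp : 1 ≤ p) (u v : E) :
    ‖u + v‖ₑ ^ p ≤ 2 ^ (p - 1) * (‖u‖ₑ ^ p + ‖v‖ₑ ^ p) :=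
  (ENNReal.rpow_le_rpow (enorm_add_le u v) (by linarith)).trans
    (ENNReal.rpow_add_le_mul_rpow_add_rpow _ _ hp)

theorem enorm_sub_rpow_le {E : Type*} [NormedAddCommGroup E] (hp : 1 ≤ p) (u v : E) :
    ‖u - v‖ₑ ^ p ≤ 2 ^ (p - 1) * (‖u‖ₑ ^ p + ‖v‖ₑ ^ p) := by
  rw [sub_eq_add_neg, ← enorm_neg v]
  exact enorm_add_rpow_le hp u (-v)

/-- Only the intermediate point has to lie in `ω`: if an end point does not, the left side vanishes.
-/
theorem pairEnergy_triangle (hp : 1 ≤ p) (x y : Fin n → ℝ) {v : Fin n → ℝ} (hv : v ∈ ω) :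
    pairEnergy p ω f x y ≤ 2 ^ (p - 1) * (pairEnergy p ω f x v + pairEnergy p ω f v y) := by
  by_cases h : (x, y) ∈ ω ×ˢ ω
  · rw [pairEnergy_of_mem h.1 h.2, pairEnergy_of_mem h.1 hv, pairEnergy_of_mem hv h.2,
      ← sub_add_sub_cancel (f x) (f v) (f y)]
    exact enorm_add_rpow_le hp _ _
  · rw [pairEnergy, indicator_of_notMem h]
    exact zero_le

/-- Tonelli and the substitution `y = x + k`. -/
theorem lintegral_totalIncrement_eq {W : (Fin n → ℝ) → (Fin n → ℝ) → ℝ≥0∞}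
    (hW : Measurable (Function.uncurry W)) {g : (Fin n → ℝ) → ℝ≥0∞} (hg : Measurable g) :
    ∫⁻ k, totalIncrement W k * g k = ∫⁻ x, ∫⁻ y, W x y * g (y - x) := by
  have h1 : ∀ k, totalIncrement W k * g k = ∫⁻ x, W x (x + k) * g k := fun k => by
    rw [totalIncrement, lintegral_mul_const]
    exact hW.comp (f := fun x : Fin n → ℝ => (x, x + k)) (by fun_prop)
  simp only [h1]
  rw [lintegral_lintegral_swap (f := fun k x => W x (x + k) * g k)]
  · refine lintegral_congr fun x => ?_
    rw [← lintegral_sub_right_eq_self _ x]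
    simp
  · exact ((hW.comp (f := fun a : (Fin n → ℝ) × (Fin n → ℝ) => (a.2, a.2 + a.1))
      (by fun_prop)).mul (hg.comp measurable_fst)).aemeasurable

theorem gagliardoEnergy_eq (hω : MeasurableSet ω) (s : ℝ) :
    gagliardoEnergy s p ω f =
      ∫⁻ x, ∫⁻ y, pairEnergy p ω f x y * (‖y - x‖ₑ ^ ((n : ℝ) + s * p))⁻¹ := by
  rw [gagliardoEnergy, ← lintegral_indicator hω]
  refine lintegral_congr fun x => ?_
  by_cases hx : x ∈ ω
  · rw [indicator_of_mem hx, ← lintegral_indicator hω]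
    refine lintegral_congr fun y => ?_
    by_cases hy : y ∈ ω
    · rw [indicator_of_mem hy, pairEnergy_of_mem hx hy, div_eq_mul_inv, enorm_sub_rev x y]
    · rw [indicator_of_notMem hy, pairEnergy, indicator_of_notMem fun h => hy h.2, zero_mul]
  · rw [indicator_of_notMem hx]
    symm
    rw [← lintegral_zero (μ := (volume : Measure (Fin n → ℝ)))]
    refine lintegral_congr fun y => ?_
    rw [pairEnergy, indicator_of_notMem fun h => hx h.1, zero_mul]

/-- Absolute continuity of the integral: the full energy is finite and the balls shrink to measure
zero. -/
theorem tendsto_localEnergy_zero (hn : 0 < n) (hω : MeasurableSet ω) (hf : Measurable f) {s : ℝ}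
    (hE : gagliardoEnergy s p ω f ≠ ∞) {R : ℕ → ℝ} (hR : Tendsto R atTop (𝓝[>] 0)) :
    Tendsto (fun k => localEnergy (pairEnergy p ω f) ((n : ℝ) + s * p) (R k)) atTop (𝓝 0) := by
  have hW := measurable_pairEnergy (p := p) hω hf
  rw [gagliardoEnergy_eq hω, ← lintegral_totalIncrement_eq hW
    (measurable_inv_enorm_rpow _)] at hE
  refine tendsto_setLIntegral_zero hE ?_
  have hpos : ∀ᶠ k in atTop, 0 < R k := hR.eventually self_mem_nhdsWithin
  have h0 : Tendsto R atTop (𝓝 0) := hR.mono_right nhdsWithin_le_nhds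
  have : Tendsto (fun k => ENNReal.ofReal ((2 * R k) ^ n)) atTop (𝓝 0) := by
    have h1 : Tendsto (fun k => (2 * R k) ^ n) atTop (𝓝 0) := by
      have := (h0.const_mul 2).pow n
      rwa [mul_zero, zero_pow hn.ne'] at this
    simpa using ENNReal.tendsto_ofReal h1
  refine this.congr' ?_
  filter_upwards [hpos] with k hk
  rw [Function.comp_apply, Real.volume_pi_ball _ hk, Fintype.card_fin]

/-- Comparison of the energy of `f ∘ P - f` with displacements and near energies. -/
theorem gagliardoEnergy_comp_sub_le (hp : 1 ≤ p) (hω : MeasurableSet ω) (hf : Measurable f)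
    {A : Set (Fin n → ℝ)} (hA : MeasurableSet A) (hAω : A ⊆ ω) {P : (Fin n → ℝ) → Fin n → ℝ}
    (hP : Measurable P) (hPω : ∀ x ∈ A, P x ∈ ω) {s δ : ℝ} (hδ : 0 < δ) :
    gagliardoEnergy s p A (fun x => f (P x) - f x) ≤
      2 ^ (p - 1) * (2 * ((∫⁻ h in {h : Fin n → ℝ | 1 ≤ ‖h‖}, (‖h‖ₑ ^ ((n : ℝ) + s * p))⁻¹) *
        (ENNReal.ofReal δ ^ ((n : ℝ) - ((n : ℝ) + s * p)) *
          ∫⁻ x in A, pairEnergy p ω f x (P x))) +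
        localEnergy (pairEnergy p ω f) ((n : ℝ) + s * p) δ +
        nearEnergy (pairEnergy p ω f) ((n : ℝ) + s * p) δ A P) := by
  set q := (n : ℝ) + s * p
  set W := pairEnergy p ω f
  have hW : Measurable (Function.uncurry W) := measurable_pairEnergy hω hf
  set U := ∫⁻ x in A, W x (P x)
  set far : (Fin n → ℝ) → ℝ≥0∞ := {h : Fin n → ℝ | δ ≤ ‖h‖}.indicator fun h => (‖h‖ₑ ^ q)⁻¹
  set nr : (Fin n → ℝ) → ℝ≥0∞ := (Metric.ball 0 δ).indicator fun h => (‖h‖ₑ ^ q)⁻¹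
  have hfar : Measurable far := (measurable_inv_enorm_rpow q).indicator (measurableSet_le_norm δ)
  have hnr : Measurable nr :=
    (measurable_inv_enorm_rpow q).indicator Metric.isOpen_ball.measurableSet
  have hWP : Measurable fun x => W x (P x) := hW.comp (measurable_id.prodMk hP)
  have hWPP : Measurable fun a : (Fin n → ℝ) × (Fin n → ℝ) => W (P a.1) (P a.2) :=
    hW.comp ((hP.comp measurable_fst).prodMk (hP.comp measurable_snd))
  have hsub : Measurable fun a : (Fin n → ℝ) × (Fin n → ℝ) => a.2 - a.1 := by fun_prop
  have hfs : Measurable fun a : (Fin n → ℝ) × (Fin n → ℝ) => far (a.2 - a.1) := hfar.comp hsub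
  have hns : Measurable fun a : (Fin n → ℝ) × (Fin n → ℝ) => nr (a.2 - a.1) := hnr.comp hsub
  set t1 : (Fin n → ℝ) → (Fin n → ℝ) → ℝ≥0∞ := fun x y => W x (P x) * far (y - x)
  set t2 : (Fin n → ℝ) → (Fin n → ℝ) → ℝ≥0∞ := fun x y => W y (P y) * far (y - x)
  set t3 : (Fin n → ℝ) → (Fin n → ℝ) → ℝ≥0∞ := fun x y => W x y * nr (y - x)
  set t4 : (Fin n → ℝ) → (Fin n → ℝ) → ℝ≥0∞ := fun x y => W (P x) (P y) * nr (y - x)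
  have m1 : Measurable (Function.uncurry t1) := (hWP.comp measurable_fst).mul hfs
  have m2 : Measurable (Function.uncurry t2) := (hWP.comp measurable_snd).mul hfs
  have m3 : Measurable (Function.uncurry t3) := hW.mul hns
  have m4 : Measurable (Function.uncurry t4) := hWPP.mul hns
  -- Distant pairs keep the grouping into displacements `f (P x) - f x` and `f (P y) - f y`, since
  -- the kernel is integrable there. Near pairs are regrouped as `f (P x) - f (P y)` minus `f x - f
  -- y`, whose smallness compensates the singular kernel.
  have hpt : ∀ x ∈ A, ∀ y ∈ A,
      ‖(f (P x) - f x) - (f (P y) - f y)‖ₑ ^ p / ‖x - y‖ₑ ^ q ≤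
        2 ^ (p - 1) * (t1 x y + t2 x y + t3 x y + t4 x y) := fun x hx y hy => by
    rw [div_eq_mul_inv, enorm_sub_rev x y]
    by_cases hxy : δ ≤ ‖y - x‖
    · have e1 : far (y - x) = (‖y - x‖ₑ ^ q)⁻¹ := indicator_of_mem (by exact hxy) _
      have e2 : nr (y - x) = 0 := indicator_of_notMem (by simpa using hxy) _
      simp only [t1, t2, t3, t4, W, e1, e2, mul_zero, add_zero]
      rw [pairEnergy_of_mem (hAω hx) (hPω x hx), pairEnergy_of_mem (hAω hy) (hPω y hy), ← add_mul,
        ← mul_assoc, enorm_sub_rev (f x), enorm_sub_rev (f y)]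
      gcongr
      exact enorm_sub_rpow_le hp _ _
    · have e1 : far (y - x) = 0 := indicator_of_notMem (by exact hxy) _
      have e2 : nr (y - x) = (‖y - x‖ₑ ^ q)⁻¹ := indicator_of_mem (by simpa using hxy) _
      simp only [t1, t2, t3, t4, W, e1, e2, mul_zero, zero_add]
      rw [pairEnergy_of_mem (hAω hx) (hAω hy), pairEnergy_of_mem (hPω x hx) (hPω y hy), ← add_mul,
        ← mul_assoc, sub_sub_sub_comm, add_comm (‖f x - f y‖ₑ ^ p)]
      gcongr
      exact enorm_sub_rpow_le hp _ _
  have hfarI : ∫⁻ h, far h =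
      ENNReal.ofReal δ ^ ((n : ℝ) - q) * ∫⁻ h in {h : Fin n → ℝ | 1 ≤ ‖h‖}, (‖h‖ₑ ^ q)⁻¹ := by
    rw [lintegral_indicator (measurableSet_le_norm δ), setLIntegral_inv_enorm_rpow_eq hδ]
  have i1 : ∫⁻ x in A, ∫⁻ y in A, t1 x y ≤ U * ∫⁻ h, far h := by
    rw [← lintegral_mul_const _ hWP]
    refine lintegral_mono fun x => (setLIntegral_le_lintegral _ _).trans ?_
    rw [← lintegral_sub_right_eq_self far x]
    exact (lintegral_const_mul _ (hfs.comp (measurable_prodMk_left (x := x)))).le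
  have i2 : ∫⁻ x in A, ∫⁻ y in A, t2 x y ≤ U * ∫⁻ h, far h := by
    rw [lintegral_lintegral_swap m2.aemeasurable, ← lintegral_mul_const _ hWP]
    refine lintegral_mono fun y => (setLIntegral_le_lintegral _ _).trans ?_
    rw [← lintegral_sub_left_eq_self far y]
    exact (lintegral_const_mul _ (hfs.comp (measurable_prodMk_right (y := y)))).le
  have i3 : ∫⁻ x in A, ∫⁻ y in A, t3 x y ≤ localEnergy W q δ := by
    calc ∫⁻ x in A, ∫⁻ y in A, t3 x y ≤ ∫⁻ x, ∫⁻ y, t3 x y :=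
          (setLIntegral_le_lintegral _ _).trans
            (lintegral_mono fun x => setLIntegral_le_lintegral _ _)
      _ = ∫⁻ k, totalIncrement W k * nr k := (lintegral_totalIncrement_eq hW hnr).symm
      _ = _ := by
          rw [localEnergy, ← lintegral_indicator Metric.isOpen_ball.measurableSet]
          refine lintegral_congr fun k => ?_
          exact (indicator_mul_right (f := totalIncrement W) _ _).symm
  have i4 : ∫⁻ x in A, ∫⁻ y in A, t4 x y ≤ nearEnergy W q δ A P := by
    refine lintegral_mono fun x => (setLIntegral_le_lintegral _ _).trans_eq ?_
    rw [← lintegral_indicator Metric.isOpen_ball.measurableSet,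
      ← lintegral_add_left_eq_self _ x]
    refine lintegral_congr fun k => ?_
    simp only [t4, nr, add_sub_cancel_left]
    exact (indicator_mul_right (f := fun k => W (P x) (P (x + k))) _ _).symm
  have hms : ∀ {t : (Fin n → ℝ) → (Fin n → ℝ) → ℝ≥0∞}, Measurable (Function.uncurry t) →
      Measurable fun x => ∫⁻ y in A, t x y := fun h => h.lintegral_prod_right'
  have hmx : ∀ {t : (Fin n → ℝ) → (Fin n → ℝ) → ℝ≥0∞}, Measurable (Function.uncurry t) →
      ∀ x, Measurable fun y => t x y := fun h x => h.comp measurable_prodMk_left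
  calc gagliardoEnergy s p A (fun x => f (P x) - f x)
      ≤ ∫⁻ x in A, ∫⁻ y in A, 2 ^ (p - 1) * (t1 x y + t2 x y + t3 x y + t4 x y) :=
        setLIntegral_mono' hA fun x hx => setLIntegral_mono' hA fun y hy => hpt x hx y hy
    _ = 2 ^ (p - 1) * ((∫⁻ x in A, ∫⁻ y in A, t1 x y) + (∫⁻ x in A, ∫⁻ y in A, t2 x y) +
          (∫⁻ x in A, ∫⁻ y in A, t3 x y) + ∫⁻ x in A, ∫⁻ y in A, t4 x y) := by
        have hM : (2 : ℝ≥0∞) ^ (p - 1) ≠ ∞ := ENNReal.rpow_ne_top_of_nonneg (by linarith) (by simp)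
        simp only [lintegral_const_mul' _ _ hM, lintegral_add_right _ (hmx m4 _),
          lintegral_add_right _ (hmx m3 _), lintegral_add_right _ (hmx m2 _)]
        rw [lintegral_add_right _ (hms m4), lintegral_add_right _ (hms m3),
          lintegral_add_right _ (hms m2)]
    _ ≤ 2 ^ (p - 1) * (U * (∫⁻ h, far h) + U * (∫⁻ h, far h) + localEnergy W q δ +
          nearEnergy W q δ A P) := by gcongr
    _ = _ := by
        rw [hfarI]
        ring

end Energy

/-! ### Homogeneity of the composed maps and covering meshes. -/

section Mesh

variable {n : ℕ}

theorem meshRetraction_eq (j : ℕ) {δ : ℝ} (hδ : δ ≠ 0) (τ x : Fin n → ℝ) :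
    meshRetraction j δ τ x = δ • (cellRetraction j (δ⁻¹ • x + τ) - τ) := by
  simp only [meshRetraction, cellShift, smul_sub, smul_add, smul_inv_smul₀ hδ]
  abel

theorem abs_signType_cast {σ : SignType} (h : σ ≠ 0) : |((σ : SignType) : ℝ)| = 1 := by
  cases σ
  · exact absurd rfl h
  · simp
  · simp

/-- A map composed with the retraction onto the `j`-skeleton is piecewise `j`-homogeneous. -/
theorem CubicMesh.isPiecewiseHomogeneous_comp {α : Type*} (C : CubicMesh n) {δ : ℝ}
    {τ : Fin n → ℝ} (hT : C.T = -(δ • τ)) (hε : 2 * C.ε = δ) {j : ℕ} (hj : j < n)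
    (f : (Fin n → ℝ) → α) : C.IsPiecewiseHomogeneous j fun x => f (meshRetraction j δ τ x) := by
  -- All the intermediate maps `G l` are the same map: each step projects radially inside a face of
  -- dimension `l + 1 > j`, where the retraction does not change.
  refine ⟨fun _ x => f (meshRetraction j δ τ x), fun _ _ => rfl, ?_, fun _ _ => rfl⟩
  intro l hjl _ K _ σ hσ x hx hxz
  have hεp := C.ε_pos
  have hδ : 0 < δ := by linarith
  set z := C.faceCenter K σ with hz
  set t := C.ε / ‖x - z‖ with ht
  have hnorm : 0 < ‖x - z‖ := norm_pos_iff.2 (sub_ne_zero.2 hxz)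
  have ht0 : 0 < t := by positivity
  set x' := z + t • (x - z) with hx'
  have hTi : ∀ i, C.T i = -(δ * τ i) := fun i => by rw [hT]; rfl
  have hzi : ∀ i, z i = C.T i + δ * K i + C.ε * ((σ i : SignType) : ℝ) := fun i => by
    rw [hz, CubicMesh.faceCenter, hε]
  have hxi' : ∀ i, x' i - z i = t * (x i - z i) := fun i => by simp [hx']
  have hfree : ∀ i, σ i = 0 → z i = C.T i + δ * K i := fun i hi => by
    rw [hzi, hi]
    simp
  have hfix : ∀ i, σ i ≠ 0 → x i = z i ∧ x' i = x i := fun i hi => by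
    have h1 := (hx i).2 hi
    refine ⟨h1, ?_⟩
    have := hxi' i
    rw [show x i - z i = 0 from sub_eq_zero.2 h1, mul_zero, sub_eq_zero] at this
    rw [this, h1]
  -- Rescaling turns the cube of index `K` into the unit cube centered at the integer point `K`.
  have hcoord : ∀ (y : Fin n → ℝ) i, (δ⁻¹ • y + τ) i - K i = δ⁻¹ * (y i - (C.T i + δ * K i)) := by
    intro y i
    rw [hTi]
    simp only [Pi.add_apply, Pi.smul_apply, smul_eq_mul]
    field_simp
    ring
  have hhalf : δ⁻¹ * C.ε = 1 / 2 := by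
    rw [← hε]
    field_simp
  have hsig : ∀ i, σ i ≠ 0 → |(δ⁻¹ • x + τ) i - K i| = 1 / 2 := fun i hi => by
    rw [hcoord, (hfix i hi).1, hzi, add_sub_cancel_left, ← mul_assoc, hhalf, abs_mul,
      abs_signType_cast hi, mul_one]
    norm_num
  have hin : ∀ (y : Fin n → ℝ) i, σ i = 0 → |y i - z i| ≤ C.ε →
      |(δ⁻¹ • y + τ) i - K i| ≤ 1 / 2 := fun y i hi hy => by
    rw [hcoord, ← hfree i hi, abs_mul, abs_of_pos (inv_pos.2 hδ), ← hhalf]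
    gcongr
  have hxx' : ∀ i, σ i ≠ 0 → (δ⁻¹ • x' + τ) i = (δ⁻¹ • x + τ) i := fun i hi => by
    simp [(hfix i hi).2]
  change f (meshRetraction j δ τ x) = f (meshRetraction j δ τ x')
  rw [meshRetraction_eq j hδ.ne', meshRetraction_eq j hδ.ne',
    cellRetraction_scale (z' := δ⁻¹ • x' + τ) (z := δ⁻¹ • x + τ) hj (k := K)
      (I := Finset.univ.filter fun i => σ i = 0) (t := t) _ ht0]
  · intro i
    by_cases hi : σ i = 0
    · exact hin x i hi (hx i).1
    · exact (hsig i hi).le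
  · intro i
    by_cases hi : σ i = 0
    · refine hin x' i hi ?_
      rw [hxi', abs_mul, abs_of_pos ht0, ht, div_mul_eq_mul_div, div_le_iff₀ hnorm]
      have : |x i - z i| ≤ ‖x - z‖ := norm_le_pi_norm (x - z) i
      gcongr
    · rw [hxx' i hi]
      exact (hsig i hi).le
  · intro i hi
    exact hsig i (by simpa using hi)
  · intro i hi
    exact hxx' i (by simpa using hi)
  · intro i hi
    have hi' : σ i = 0 := by simpa using hi
    rw [hcoord, hcoord, ← hfree i hi', hxi']
    ring
  · change faceDim σ = l + 1 at hσ
    rw [faceDim] at hσ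
    omega

/-- The cubes of the mesh of size `2ε` with center `T` which meet a bounded set. -/
theorem CubicMesh.exists_cover (T : Fin n → ℝ) {ε : ℝ} (hε : 0 < ε) {S : Set (Fin n → ℝ)}
    (hS : Bornology.IsBounded S) :
    ∃ C : CubicMesh n, C.T = T ∧ C.ε = ε ∧ S ⊆ C.carrier ∧
      ∀ x ∈ C.carrier, ∃ y ∈ S, ‖x - y‖ ≤ 2 * ε := by
  set I : Set (Fin n → ℤ) := {K | ∃ y ∈ S, ∀ i, |y i - (T i + 2 * ε * (K i : ℝ))| ≤ ε} with hI
  have hfin : I.Finite := by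
    obtain ⟨R, hR⟩ := hS.exists_norm_le
    set c : ℤ := ⌈(R + ‖T‖ + ε) / (2 * ε)⌉ with hc
    refine (Set.finite_Icc (fun _ : Fin n => -c) (fun _ => c)).subset ?_
    rintro K ⟨y, hy, hK⟩
    have key : ∀ i, |(K i : ℝ)| ≤ c := fun i => by
      refine le_trans ?_ (Int.le_ceil _)
      rw [le_div_iff₀ (by positivity)]
      have h1 : |y i| ≤ R := (norm_le_pi_norm y i).trans (hR y hy)
      have h2 : |T i| ≤ ‖T‖ := norm_le_pi_norm T i
      have h3 := hK i
      have h4 : |(K i : ℝ)| * (2 * ε) = |2 * ε * (K i : ℝ)| := by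
        rw [abs_mul, abs_of_pos (by positivity : 0 < 2 * ε), mul_comm]
      rw [h4]
      rw [abs_le] at *
      constructor <;> linarith [h1.1, h1.2, h2.1, h2.2, h3.1, h3.2]
    refine ⟨fun i => ?_, fun i => ?_⟩
    · have := (abs_le.1 (key i)).1
      exact_mod_cast this
    · have := (abs_le.1 (key i)).2
      exact_mod_cast this
  refine ⟨⟨T, ε, hε, hfin.toFinset⟩, rfl, rfl, fun x hx => ?_, ?_⟩
  · have hx' : ∀ i, |x i - (T i + 2 * ε * (round ((x i - T i) / (2 * ε)) : ℝ))| ≤ ε := fun i => by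
      have h := abs_sub_round ((x i - T i) / (2 * ε))
      have e : x i - (T i + 2 * ε * (round ((x i - T i) / (2 * ε)) : ℝ)) =
          2 * ε * ((x i - T i) / (2 * ε) - round ((x i - T i) / (2 * ε))) := by
        field_simp
        ring
      rw [e, abs_mul, abs_of_pos (by positivity : 0 < 2 * ε)]
      nlinarith
    exact ⟨fun i => round ((x i - T i) / (2 * ε)), hfin.mem_toFinset.2 ⟨x, hx, hx'⟩, hx'⟩
  · rintro x ⟨K, hK, hxK⟩
    obtain ⟨y, hy, hyK⟩ := hfin.mem_toFinset.1 hK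
    refine ⟨y, hy, (pi_norm_le_iff_of_nonneg (by positivity)).2 fun i => ?_⟩
    have h1 := abs_le.1 (hxK i)
    have h2 := abs_le.1 (hyK i)
    simp only at h1
    rw [Pi.sub_apply, Real.norm_eq_abs, abs_le]
    constructor <;> linarith [h1.1, h1.2, h2.1, h2.2]

end Mesh

/-! ### Sobolev norms and the approximation estimate. -/

section Sobolev

variable {n m : ℕ} {s p : ℝ} {A A' ω : Set (Fin n → ℝ)}
  {f g : (Fin n → ℝ) → EuclideanSpace ℝ (Fin m)}

theorem gagliardoEnergy_mono (h : A ⊆ A') : gagliardoEnergy s p A f ≤ gagliardoEnergy s p A' f :=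
  (lintegral_mono_set h).trans (lintegral_mono fun _ => lintegral_mono_set h)

theorem sobolevNorm_mono (hp : 1 ≤ p) (h : A ⊆ A') : sobolevNorm s p A f ≤ sobolevNorm s p A' f :=
  add_le_add (eLpNorm_mono_measure f (Measure.restrict_mono_set _ h))
    (ENNReal.rpow_le_rpow (gagliardoEnergy_mono h) (by positivity))

theorem sobolevNorm_congr (h : f =ᵐ[volume.restrict A] g) :
    sobolevNorm s p A f = sobolevNorm s p A g := by
  rw [sobolevNorm, sobolevNorm, eLpNorm_congr_ae h, gagliardoEnergy, gagliardoEnergy]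
  congr 2
  refine lintegral_congr_ae ?_
  filter_upwards [h] with x hx
  refine lintegral_congr_ae ?_
  filter_upwards [h] with y hy
  rw [hx, hy]

theorem gagliardoEnergy_lt_top_of_sobolevNorm (hp : 1 ≤ p) (h : sobolevNorm s p A f < ∞) :
    gagliardoEnergy s p A f < ∞ :=
  (ENNReal.rpow_lt_top_iff_of_pos (by positivity)).1 ((le_add_self).trans_lt h)

theorem gagliardoEnergy_add_le (hp : 1 ≤ p) (hf : Measurable f) :
    gagliardoEnergy s p A (fun x => f x + g x) ≤
      2 ^ (p - 1) * (gagliardoEnergy s p A f + gagliardoEnergy s p A g) := by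
  have hM : (2 : ℝ≥0∞) ^ (p - 1) ≠ ∞ := ENNReal.rpow_ne_top_of_nonneg (by linarith) (by simp)
  have hm : Measurable fun a : (Fin n → ℝ) × (Fin n → ℝ) =>
      ‖f a.1 - f a.2‖ₑ ^ p / ‖a.1 - a.2‖ₑ ^ ((n : ℝ) + s * p) := by fun_prop
  calc gagliardoEnergy s p A (fun x => f x + g x)
      ≤ ∫⁻ x in A, ∫⁻ y in A, 2 ^ (p - 1) *
          (‖f x - f y‖ₑ ^ p / ‖x - y‖ₑ ^ ((n : ℝ) + s * p) +
            ‖g x - g y‖ₑ ^ p / ‖x - y‖ₑ ^ ((n : ℝ) + s * p)) := by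
        refine lintegral_mono fun x => lintegral_mono fun y => ?_
        simp only [div_eq_mul_inv]
        rw [← add_mul, ← mul_assoc, add_sub_add_comm]
        gcongr
        exact enorm_add_rpow_le hp _ _
    _ = _ := by
        simp only [lintegral_const_mul' _ _ hM, gagliardoEnergy]
        congr 1
        rw [← lintegral_add_left hm.lintegral_prod_right']
        refine lintegral_congr fun x => ?_
        exact lintegral_add_left (hm.comp (measurable_prodMk_left (x := x))) _

theorem sobolevNorm_add_lt_top (hp : 1 ≤ p) (hf : Measurable f) (hg : Measurable g)
    (hf' : sobolevNorm s p A f < ∞) (hg' : sobolevNorm s p A g < ∞) :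
    sobolevNorm s p A (fun x => f x + g x) < ∞ := by
  have h1 : eLpNorm (f + g) (ENNReal.ofReal p) (volume.restrict A) < ∞ :=
    eLpNorm_add_lt_top ⟨hf.aestronglyMeasurable, (le_self_add).trans_lt hf'⟩
      ⟨hg.aestronglyMeasurable, (le_self_add).trans_lt hg'⟩
  have h2 := gagliardoEnergy_add_le (s := s) (A := A) (g := g) hp hf
  have h3 := gagliardoEnergy_lt_top_of_sobolevNorm hp hf'
  have h4 := gagliardoEnergy_lt_top_of_sobolevNorm hp hg'
  have hM : (2 : ℝ≥0∞) ^ (p - 1) < ∞ :=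
    ENNReal.rpow_lt_top_of_nonneg (by linarith) (by simp)
  refine ENNReal.add_lt_top.2 ⟨h1, (ENNReal.rpow_lt_top_iff_of_pos (by positivity)).2 ?_⟩
  exact h2.trans_lt (ENNReal.mul_lt_top hM (ENNReal.add_lt_top.2 ⟨h3, h4⟩))

/-- A measurable representative with values in the target everywhere. -/
theorem MemSobolev.exists_measurable {F : Set (EuclideanSpace ℝ (Fin m))}
    (hf : MemSobolev s p ω F f) (hF : F.Nonempty) :
    ∃ g : (Fin n → ℝ) → EuclideanSpace ℝ (Fin m), Measurable g ∧ (∀ x, g x ∈ F) ∧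
      f =ᵐ[volume.restrict ω] g := by
  obtain ⟨c, hc⟩ := hF
  classical
  set f₀ := hf.1.mk f
  have hf₀ : f =ᵐ[volume.restrict ω] f₀ := hf.1.ae_eq_mk
  have hnull : (volume.restrict ω) {x | f₀ x ∉ F} = 0 := by
    have : ∀ᵐ x ∂volume.restrict ω, f₀ x ∈ F := by
      filter_upwards [hf.2.2, hf₀] with x h1 h2
      rwa [← h2]
    exact ae_iff.1 this
  set N := toMeasurable (volume.restrict ω) {x | f₀ x ∉ F}
  have hN : (volume.restrict ω) N = 0 := by rw [measure_toMeasurable, hnull]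
  refine ⟨N.piecewise (fun _ => c) f₀, ?_, fun x => ?_, ?_⟩
  · exact Measurable.piecewise (measurableSet_toMeasurable _ _) measurable_const
      hf.1.stronglyMeasurable_mk.measurable
  · by_cases hx : x ∈ N
    · rwa [piecewise_eq_of_mem _ _ _ hx]
    · rw [piecewise_eq_of_notMem _ _ _ hx]
      by_contra h
      exact hx (subset_toMeasurable _ _ h)
  · filter_upwards [hf₀, measure_eq_zero_iff_ae_notMem.1 hN] with x h1 h2
    rw [piecewise_eq_of_notMem _ _ _ h2, h1]

/-- Approximation by composition with the retraction onto the `j`-skeleton of a fine mesh. -/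
theorem exists_sobolevNorm_comp_sub_le (hs : 0 < s) (hp : 1 ≤ p) (hω : MeasurableSet ω)
    (hf : Measurable f) {j : ℕ} (hj : j < n) (hsp : s * p < (j : ℝ) + 1) :
    ∃ B : ℝ≥0∞, B ≠ ∞ ∧ ∀ δ : ℝ, 0 < δ → δ ≤ 1 → ∀ A : Set (Fin n → ℝ), MeasurableSet A →
      (∀ x ∈ A, ∀ w, ‖w‖ < 4 * δ → x + w ∈ ω) → ∃ τ : Fin n → ℝ,
        sobolevNorm s p A (fun x => f (meshRetraction j δ τ x) - f x) ≤
          B * localEnergy (pairEnergy p ω f) ((n : ℝ) + s * p) (4 * δ) ^ (1 / p) := by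
  have hp0 : 0 < p := by linarith
  have hM : (2 : ℝ≥0∞) ^ (p - 1) ≠ ∞ := ENNReal.rpow_ne_top_of_nonneg (by linarith) (by simp)
  have hq : (n : ℝ) < (n : ℝ) + s * p := by
    have : 0 < s * p := by positivity
    linarith
  obtain ⟨B, hB, hmain⟩ := exists_meshRetraction_energy_le (W := pairEnergy p ω f) (ω := ω)
    (measurable_pairEnergy hω hf) hM (fun x y v hv => pairEnergy_triangle hp x y hv) hj hq
    (by linarith)
  have hc := (lintegral_inv_enorm_rpow_lt_top hq).ne
  have hip : 0 ≤ 1 / p := by positivity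
  set q := (n : ℝ) + s * p
  set c := ∫⁻ h in {h : Fin n → ℝ | 1 ≤ ‖h‖}, (‖h‖ₑ ^ q)⁻¹
  set B' := (2 : ℝ≥0∞) ^ (p - 1) * (2 * (c * B) + 1 + B)
  have hB' : B' ≠ ∞ := by finiteness
  refine ⟨B ^ (1 / p) + B' ^ (1 / p), ?_, fun δ hδ hδ1 A hA hAω => ?_⟩
  · exact ENNReal.add_ne_top.2 ⟨ENNReal.rpow_ne_top_of_nonneg hip hB,
      ENNReal.rpow_ne_top_of_nonneg hip hB'⟩
  obtain ⟨τ, hτ⟩ := hmain δ hδ A hA hAω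
  refine ⟨τ, ?_⟩
  set P := meshRetraction j δ τ
  set J := localEnergy (pairEnergy p ω f) q (4 * δ)
  have hP : Measurable P := (measurable_meshRetraction hj δ).comp measurable_prodMk_left
  have hAω' : A ⊆ ω := fun x hx => by
    simpa using hAω x hx 0 (by simpa using hδ)
  have hPω : ∀ x ∈ A, P x ∈ ω := fun x hx => by
    have h1 := norm_meshRetraction_sub_self_le hj hδ τ x
    have h2 := hAω x hx (P x - x) (lt_of_le_of_lt h1 (by linarith))
    rwa [add_sub_cancel] at h2
  set U := ∫⁻ x in A, pairEnergy p ω f x (P x)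
  have hU1 : ENNReal.ofReal δ ^ ((n : ℝ) - q) * U ≤ B * J := le_self_add.trans hτ
  have hnear : nearEnergy (pairEnergy p ω f) q δ A P ≤ B * J := le_add_self.trans hτ
  -- Since `δ ≤ 1` and `n - q < 0`, the weight is at least `1`, so the weighted displacement also
  -- controls the `L^p` norm.
  have hU2 : U ≤ B * J := by
    refine le_trans ?_ hU1
    have h1 : ENNReal.ofReal δ ≤ 1 := by
      rw [← ENNReal.ofReal_one]
      exact ENNReal.ofReal_le_ofReal hδ1
    have h2 : 1 ≤ ENNReal.ofReal δ ^ ((n : ℝ) - q) := by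
      rw [← neg_sub, ENNReal.rpow_neg, ENNReal.one_le_inv]
      exact ENNReal.rpow_le_one h1 (by linarith)
    calc U = 1 * U := (one_mul _).symm
      _ ≤ _ := by gcongr
  have hLp : eLpNorm (fun x => f (P x) - f x) (ENNReal.ofReal p) (volume.restrict A) ≤
      B ^ (1 / p) * J ^ (1 / p) := by
    rw [eLpNorm_eq_lintegral_rpow_enorm_toReal (by simpa using hp0) (by simp),
      ENNReal.toReal_ofReal hp0.le, ← ENNReal.mul_rpow_of_nonneg _ _ hip]
    refine ENNReal.rpow_le_rpow ?_ hip
    refine le_trans (setLIntegral_mono' hA fun x hx => ?_) hU2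
    rw [pairEnergy_of_mem (hAω' hx) (hPω x hx), enorm_sub_rev]
  have hE : gagliardoEnergy s p A (fun x => f (P x) - f x) ≤ B' * J := by
    refine (gagliardoEnergy_comp_sub_le hp hω hf hA hAω' hP hPω hδ).trans ?_
    calc _ ≤ (2 : ℝ≥0∞) ^ (p - 1) * (2 * (c * (B * J)) + J + B * J) := by
          gcongr
          exact localEnergy_mono (by linarith)
      _ = _ := by ring
  calc sobolevNorm s p A (fun x => f (P x) - f x)
      ≤ B ^ (1 / p) * J ^ (1 / p) + (B' * J) ^ (1 / p) :=
        add_le_add hLp (ENNReal.rpow_le_rpow hE hip)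
    _ = _ := by
        rw [ENNReal.mul_rpow_of_nonneg _ _ hip, add_mul]

end Sobolev

/-! ### The approximation theorem. -/

theorem theorem1p5 {n m : ℕ} (F : Set (EuclideanSpace ℝ (Fin m))) (s p : ℝ)
    (hs0 : 0 < s) (hs1 : s < 1) (hp : 1 ≤ p) (hspn : s * p < n)
    (Ω ω : Set (Fin n → ℝ)) (hΩ : IsSmoothOpen Ω) (hω : IsSmoothOpen ω)
    (hΩb : Bornology.IsBounded Ω) (hωb : Bornology.IsBounded ω) (hΩω : closure Ω ⊆ ω)
    (f : (Fin n → ℝ) → EuclideanSpace ℝ (Fin m)) (hf : MemSobolev s p ω F f)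
    (j : ℕ) (hj : ⌊s * p⌋₊ ≤ j) (hjn : j < n) :
    ∃ (C : ℕ → CubicMesh n) (fk : ℕ → (Fin n → ℝ) → EuclideanSpace ℝ (Fin m)),
      (∀ k, closure Ω ⊆ (C k).carrier ∧ (C k).carrier ⊆ ω) ∧
      (∀ k, ∀ x ∈ (C k).carrier, fk k x ∈ F) ∧
      (∀ k, (C k).IsPiecewiseHomogeneous j (fk k)) ∧
      (∀ k, MemSobolev s p (C k).carrier F (fk k)) ∧
      Tendsto (fun k => sobolevNorm s p Ω (fun x => fk k x - f x)) atTop (𝓝 0) := by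
  have hp0 : 0 < p := by linarith
  have hn : 0 < n := by omega
  rcases F.eq_empty_or_nonempty with rfl | hF
  -- If `F` is empty, the open set `ω` is null, hence empty, and a mesh without cubes suffices.
  · have hω0 : ω = ∅ := by
      have h1 : ∀ᵐ x ∂volume.restrict ω, False := by
        filter_upwards [hf.2.2] with x hx using hx
      rw [eventually_false_iff_eq_bot, ae_eq_bot, Measure.restrict_eq_zero] at h1
      exact (hω.1.measure_eq_zero_iff volume).1 h1
    have hΩ0 : closure Ω = ∅ := subset_empty_iff.1 (hω0 ▸ hΩω)
    have hΩ1 : Ω = ∅ := closure_empty_iff Ω |>.1 hΩ0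
    obtain ⟨C, -, -, -, hC⟩ := CubicMesh.exists_cover (0 : Fin n → ℝ) one_pos
      (S := ∅) Bornology.isBounded_empty
    have hC0 : C.carrier = ∅ := by
      refine eq_empty_of_forall_notMem fun x hx => ?_
      obtain ⟨y, hy, -⟩ := hC x hx
      exact hy
    have hnorm : ∀ g : (Fin n → ℝ) → EuclideanSpace ℝ (Fin m), sobolevNorm s p ∅ g = 0 := by
      intro g
      simp [sobolevNorm, gagliardoEnergy, hp0]
    refine ⟨fun _ => C, fun _ _ => 0, fun _ => ?_, fun _ x hx => ?_, fun _ => ?_, fun _ => ?_, ?_⟩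
    · rw [hC0, hΩ0]
      exact ⟨subset_rfl, empty_subset _⟩
    · rw [hC0] at hx
      exact hx.elim
    · exact ⟨fun _ _ => 0, fun _ _ => rfl, fun _ _ _ _ _ _ _ _ _ _ => rfl, fun _ _ => rfl⟩
    · rw [hC0]
      refine ⟨aestronglyMeasurable_const, ?_, by simp⟩
      rw [hnorm]
      exact ENNReal.zero_lt_top
    · rw [hΩ1]
      simp only [hnorm]
      exact tendsto_const_nhds
  have hωm := hω.1.measurableSet
  -- The values of the composed map are taken on a thin set, so "almost everywhere in `F`" would not
  -- survive composition. A representative is fixed before the translations are chosen, with values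
  -- in `F` everywhere.
  obtain ⟨g, hg, hgF, hfg⟩ := hf.exists_measurable hF
  have hgn : sobolevNorm s p ω g < ∞ := sobolevNorm_congr hfg ▸ hf.2.1
  have hgE := (gagliardoEnergy_lt_top_of_sobolevNorm hp hgn).ne
  have hsp : s * p < (j : ℝ) + 1 := by
    refine (Nat.lt_floor_add_one (s * p)).trans_le ?_
    gcongr
  obtain ⟨B, hB, happ⟩ := exists_sobolevNorm_comp_sub_le hs0 hp hωm hg hjn hsp
  obtain ⟨η, hη, hηω⟩ := hΩb.isCompact_closure.exists_thickening_subset_open hω.1 hΩω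
  -- With `δ ≤ η/8`, the cubes meeting the closure of `Ω` stay within `δ < η/4` of it, hence in `A`,
  -- and shifts of `A` by less than `4δ ≤ η/2` stay within `η/4 + η/2 < η`, hence in `ω`.
  set a := min 1 (η / 8) with ha
  have ha0 : 0 < a := by positivity
  have ha1 : a ≤ 1 := min_le_left _ _
  have ha2 : a ≤ η / 8 := min_le_right _ _
  set δ : ℕ → ℝ := fun k => a / ((k : ℝ) + 1) with hδ
  have hδ0 : ∀ k, 0 < δ k := fun k => by positivity
  have hδa : ∀ k, δ k ≤ a := fun k => div_le_self ha0.le (by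
    have : (0 : ℝ) ≤ k := Nat.cast_nonneg k
    linarith)
  set A := Metric.thickening (η / 4) (closure Ω) with hA
  have hAm : MeasurableSet A := Metric.isOpen_thickening.measurableSet
  have hAω : ∀ k, ∀ x ∈ A, ∀ w, ‖w‖ < 4 * δ k → x + w ∈ ω := fun k x hx w hw => by
    obtain ⟨y, hy, hxy⟩ := Metric.mem_thickening_iff.1 hx
    refine hηω (Metric.mem_thickening_iff.2 ⟨y, hy, ?_⟩)
    have h1 : dist (x + w) y ≤ dist (x + w) x + dist x y := dist_triangle _ _ _
    rw [dist_eq_norm (x + w) x, add_sub_cancel_left] at h1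
    have := hδa k
    linarith
  have hΩA : Ω ⊆ A := subset_closure.trans (Metric.self_subset_thickening (by positivity) _)
  have hAsub : A ⊆ ω := fun x hx => by
    simpa using hAω 0 x hx 0 (by simpa using hδ0 0)
  choose τ hτ using fun k => happ (δ k) (hδ0 k) ((hδa k).trans ha1) A hAm (hAω k)
  choose C hCT hCε hCΩ hCd using fun k => CubicMesh.exists_cover (-(δ k • τ k))
    (half_pos (hδ0 k)) hΩb.closure
  have hCA : ∀ k, (C k).carrier ⊆ A := fun k x hx => by
    obtain ⟨y, hy, hxy⟩ := hCd k x hx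
    refine Metric.mem_thickening_iff.2 ⟨y, hy, ?_⟩
    rw [dist_eq_norm]
    have := hδa k
    linarith
  set J : ℕ → ℝ≥0∞ := fun k => localEnergy (pairEnergy p ω g) ((n : ℝ) + s * p) (4 * δ k)
  have hδt : Tendsto (fun k => 4 * δ k) atTop (𝓝[>] 0) := by
    refine tendsto_nhdsWithin_iff.2 ⟨?_, Eventually.of_forall fun k => by
      have := hδ0 k
      simpa using this⟩
    have := (tendsto_one_div_add_atTop_nhds_zero_nat (𝕜 := ℝ)).const_mul (4 * a)
    rw [mul_zero] at this
    refine this.congr fun k => ?_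
    simp only [hδ]
    ring
  have hJ : Tendsto J atTop (𝓝 0) := tendsto_localEnergy_zero hn hωm hg hgE hδt
  have hJB : Tendsto (fun k => B * J k ^ (1 / p)) atTop (𝓝 0) := by
    have h1 := (ENNReal.continuous_rpow_const (y := 1 / p)).tendsto 0 |>.comp hJ
    have h2 := ENNReal.Tendsto.const_mul (a := B) h1 (Or.inr hB)
    rwa [ENNReal.zero_rpow_of_pos (by positivity), mul_zero] at h2
  have hJfin : ∀ k, J k ≠ ∞ := fun k => by
    rw [gagliardoEnergy_eq hωm, ← lintegral_totalIncrement_eq (measurable_pairEnergy hωm hg)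
      (measurable_inv_enorm_rpow _)] at hgE
    exact ((setLIntegral_le_lintegral _ _).trans_lt hgE.lt_top).ne
  have hmeas : ∀ k, Measurable fun x => g (meshRetraction j (δ k) (τ k) x) := fun k =>
    hg.comp ((measurable_meshRetraction hjn (δ k)).comp measurable_prodMk_left)
  refine ⟨C, fun k x => g (meshRetraction j (δ k) (τ k) x), fun k => ⟨hCΩ k, (hCA k).trans hAsub⟩,
    fun k x _ => hgF _, fun k => ?_, fun k => ?_, ?_⟩
  · exact (C k).isPiecewiseHomogeneous_comp (hCT k) (by rw [hCε]; ring) hjn g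
  · refine ⟨(hmeas k).aestronglyMeasurable, ?_, Eventually.of_forall fun x => hgF _⟩
    have h1 : sobolevNorm s p A (fun x => g (meshRetraction j (δ k) (τ k) x) - g x) < ∞ :=
      (hτ k).trans_lt (ENNReal.mul_lt_top hB.lt_top
        (ENNReal.rpow_lt_top_of_nonneg (by positivity) (hJfin k)))
    -- Finiteness on the whole mesh, not only on `Ω`: the estimate holds on `A`, which contains the
    -- mesh, and `g` is added back.
    have h2 := sobolevNorm_add_lt_top hp ((hmeas k).sub hg) hg
      ((sobolevNorm_mono hp (hCA k)).trans_lt h1)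
      ((sobolevNorm_mono hp ((hCA k).trans hAsub)).trans_lt hgn)
    simpa using h2
  · refine tendsto_of_tendsto_of_tendsto_of_le_of_le tendsto_const_nhds hJB (fun k => zero_le)
      fun k => ?_
    have hfgΩ : f =ᵐ[volume.restrict Ω] g :=
      ae_restrict_of_ae_restrict_of_subset (hΩA.trans hAsub) hfg
    have e : sobolevNorm s p Ω (fun x => g (meshRetraction j (δ k) (τ k) x) - f x) =
        sobolevNorm s p Ω (fun x => g (meshRetraction j (δ k) (τ k) x) - g x) := by
      refine sobolevNorm_congr ?_
      filter_upwards [hfgΩ] with x hx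
      rw [hx]
    simp only [e]
    exact (sobolevNorm_mono hp hΩA).trans (hτ k)
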